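/- Let $\mathbb{N}=\{1,2,\dots\}$, and let $\mathcal N=\{n_1,n_2,\dots\}$ and $\mathcal M=\{m_1,m_2,\dots\}$ be disjoint, recursively enumerable, recursively inseparable subsets of $\mathbb{N}$, enumerated without repetition by computable maps $i\mapsto n_i$ and $i\mapsto m_i$ $(i\in\mathbb{N})$. (Two disjoint sets are recursively inseparable if no recursive set contains the first and is disjoint from the second.) For each $n\in\mathbb{N}$ let $A_n=\langle a_{n,0}\rangle\oplus\langle a_{n,1}\rangle$ and $B_n=\langle b_{n,0}\rangle\oplus\langle b_{n,1}\rangle$ be free abelian groups of rank two, written additively, and put $$\dot A_n=\begin{cases}A_n & n\notin\mathcal N\cup\mathcal M,\\ A_n/\langle a_{n,1}-2^i a_{n,0}\rangle & n=n_i\in\mathcal N,\\ A_n/\langle a_{n,1}-3^i a_{n,0}\rangle & n=m_i\in\mathcal M,\end{cases}\qquad \dot B_n=\begin{cases}B_n & n\notin\mathcal N\cup\mathcal M,\\ B_n/\langle b_{n,1}-2^i b_{n,0}\rangle & n=n_i\in\mathcal N\text{ or }n=m_i\in\mathcal M.\end{cases}$$ Let $\dot a_{n,m}$ and $\dot b_{n,m}$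 $(m\in\{0,1\})$ be the images of $a_{n,m}$ and $b_{n,m}$ in $\dot A_n$ and $\dot B_n$, let $T$ be the free group with basis $\{t_1,t_2,\dots\}$, and let $$\dot G=\Big(\big(\ast_{n=1}^{\infty}\dot A_n\big)\ast\big(\ast_{n=1}^{\infty}\dot B_n\big)\ast T\Big)\Big/\big\langle\!\big\langle\, t_i^{-1}\dot a_{n_i,0}\,t_i=\dot b_{n_i,0}\ \big|\ i\in\mathbb{N}\,\big\rangle\!\big\rangle .$$ Then $\dot G$ has decidable word problem with respect to this presentation. That is, $\dot G$ is generated by the elements $\dot a_{n,m},\dot b_{n,m},t_i$ $(n,i\in\mathbb{N},\ m\in\{0,1\})$; it is presented on these generators by the recursively enumerable set of relators expressing that $\dot a_{n,0},\dot a_{n,1}$ commute and $\dot b_{n,0},\dot b_{n,1}$ commute for all $n$, the relations of $\dot A_n$ and $\dot B_n$ displayed above, and the relations $t_i^{-1}\dot a_{n_i,0}t_i=\dot b_{n_i,0}$; and there is an algorithm which, given two words in these generators and their inverses, decides whether they represent the same element of $\dot G$. -/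

import Mathlib

/-- Two sets are recursively inseparable if they are disjoint and no recursive set contains the
first and is disjoint from the second. -/
def RecursivelyInseparable {α : Type*} [Primcodable α] (S₁ S₂ : Set α) : Prop :=
  Disjoint S₁ S₂ ∧
    ¬ ∃ T : Set α, ComputablePred (fun x => x ∈ T) ∧ S₁ ⊆ T ∧ S₂ ⊆ Tᶜ

/-- The element of `G` represented by a word in the letters `x`, `x⁻¹` (`x : X`), where the letter
`x` is `(x, true)`, the letter `x⁻¹` is `(x, false)`, and `x` is interpreted as `g x`. -/
def wordValue {X G : Type*} [Group G] (g : X → G) (w : List (X × Bool)) : G :=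
  FreeGroup.lift g (FreeGroup.mk w)

/-- `⟨X ∣ R⟩`, with the generators interpreted by `g : X → G`, is a computable presentation of the
group `G`: it presents `G`, the set `R` of relators is recursively enumerable, and there is an
algorithm deciding whether two given words represent the same element of `G`. (The set `X` of
letters is enumerated by its effective coding.) -/
structure IsComputablePresentation {X G : Type*} [Primcodable X] [Group G]
    (g : X → G) (R : Set (List (X × Bool))) : Prop where
  /-- the generators generate `G` -/
  surjective : Function.Surjective (FreeGroup.lift g)
  /-- the relators define `G` -/
  ker_eq : (FreeGroup.lift g).ker = Subgroup.normalClosure (FreeGroup.mk '' R)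
  /-- the set of relators is recursively enumerable -/
  relators_re : REPred (fun w => w ∈ R)
  /-- the word problem is decidable -/
  wordProblem : ComputablePred
    (fun p : List (X × Bool) × List (X × Bool) => wordValue g p.1 = wordValue g p.2)

namespace DotGroup

/-- The free abelian group of rank two, with basis `basisVec 0`, `basisVec 1`; each of the groups
`A_n` and `B_n` is a copy of it. -/
abbrev FreeAb : Type := Fin 2 → ℤ

/-- The basis elements (`a_{n,0}`, `a_{n,1}`, respectively `b_{n,0}`, `b_{n,1}`). -/
def basisVec (m : Fin 2) : FreeAb := Pi.single m 1

variable (ν μ : ℕ+ → ℕ+)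

/-- The relators imposed on `A_n`: `a_{n,1} = 2^i a_{n,0}` if `n = n_i`, `a_{n,1} = 3^i a_{n,0}` if
`n = m_i`, and none if `n` is neither an `n_i` nor an `m_i`. Here `n_i = ν i` and `m_i = μ i`. -/
def relA (n : ℕ+) : Set FreeAb :=
  {x | ∃ i : ℕ+, n = ν i ∧ x = basisVec 1 - (2 ^ (i : ℕ) : ℤ) • basisVec 0} ∪
  {x | ∃ i : ℕ+, n = μ i ∧ x = basisVec 1 - (3 ^ (i : ℕ) : ℤ) • basisVec 0}

/-- The relators imposed on `B_n`: `b_{n,1} = 2^i b_{n,0}` if `n = n_i` or `n = m_i`, and none if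
`n` is neither an `n_i` nor an `m_i`. -/
def relB (n : ℕ+) : Set FreeAb :=
  {x | ∃ i : ℕ+, (n = ν i ∨ n = μ i) ∧ x = basisVec 1 - (2 ^ (i : ℕ) : ℤ) • basisVec 0}

/-- The group `Ȧ_n`. -/
abbrev ADot (n : ℕ+) : Type := FreeAb ⧸ AddSubgroup.closure (relA ν μ n)

/-- The group `Ḃ_n`. -/
abbrev BDot (n : ℕ+) : Type := FreeAb ⧸ AddSubgroup.closure (relB ν μ n)

/-- The free product `*_n Ȧ_n`. -/
def AProd : Type := Monoid.CoprodI fun n : ℕ+ => Multiplicative (ADot ν μ n)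

instance : Group (AProd ν μ) :=
  inferInstanceAs (Group (Monoid.CoprodI fun n : ℕ+ => Multiplicative (ADot ν μ n)))

/-- The free product `*_n Ḃ_n`. -/
def BProd : Type := Monoid.CoprodI fun n : ℕ+ => Multiplicative (BDot ν μ n)

instance : Group (BProd ν μ) :=
  inferInstanceAs (Group (Monoid.CoprodI fun n : ℕ+ => Multiplicative (BDot ν μ n)))

/-- The free product `(*_n Ȧ_n) * (*_n Ḃ_n)`. -/
abbrev GDotZero : Type := Monoid.Coprod (AProd ν μ) (BProd ν μ)

/-- The free product `(*_n Ȧ_n) * (*_n Ḃ_n) * T`, with `T` free on `t_1, t_2, …`. -/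
abbrev FreeProd : Type := Monoid.Coprod (GDotZero ν μ) (FreeGroup ℕ+)

/-- `ȧ_{n,m}` in the free product. -/
def aElt (n : ℕ+) (m : Fin 2) : FreeProd ν μ :=
  Monoid.Coprod.inl (Monoid.Coprod.inl (Monoid.CoprodI.of (i := n)
    (Multiplicative.ofAdd (QuotientAddGroup.mk (basisVec m) : ADot ν μ n))))

/-- `ḃ_{n,m}` in the free product. -/
def bElt (n : ℕ+) (m : Fin 2) : FreeProd ν μ :=
  Monoid.Coprod.inl (Monoid.Coprod.inr (Monoid.CoprodI.of (i := n)
    (Multiplicative.ofAdd (QuotientAddGroup.mk (basisVec m) : BDot ν μ n))))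

/-- `t_i` in the free product. -/
def tElt (i : ℕ+) : FreeProd ν μ := Monoid.Coprod.inr (FreeGroup.of i)

/-- The relators `t_i⁻¹ ȧ_{n_i,0} t_i = ḃ_{n_i,0}`. -/
def conjRelators : Set (FreeProd ν μ) :=
  Set.range fun i : ℕ+ =>
    (tElt ν μ i)⁻¹ * aElt ν μ (ν i) 0 * tElt ν μ i * (bElt ν μ (ν i) 0)⁻¹

/-- The group `Ġ`. -/
abbrev GDot : Type := FreeProd ν μ ⧸ Subgroup.normalClosure (conjRelators ν μ)

/-- The letters: `ȧ_{n,m}`, `ḃ_{n,m}` (`n` a positive integer, `m ∈ {0, 1}`) and `t_i`. -/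
abbrev Letter : Type := (ℕ+ × Fin 2) ⊕ (ℕ+ × Fin 2) ⊕ ℕ+

/-- The letter `ȧ_{n,m}`. -/
abbrev Letter.a (n : ℕ+) (m : Fin 2) : Letter := Sum.inl (n, m)

/-- The letter `ḃ_{n,m}`. -/
abbrev Letter.b (n : ℕ+) (m : Fin 2) : Letter := Sum.inr (Sum.inl (n, m))

/-- The letter `t_i`. -/
abbrev Letter.t (i : ℕ+) : Letter := Sum.inr (Sum.inr i)

/-- The generators of `Ġ`. -/
def generator : Letter → GDot ν μ
  | Sum.inl (n, m) => QuotientGroup.mk (aElt ν μ n m)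
  | Sum.inr (Sum.inl (n, m)) => QuotientGroup.mk (bElt ν μ n m)
  | Sum.inr (Sum.inr i) => QuotientGroup.mk (tElt ν μ i)

/-- The word `x y x⁻¹ y⁻¹`. -/
def commWord (x y : Letter) : List (Letter × Bool) :=
  [(x, true), (y, true), (x, false), (y, false)]

/-- The word `x⁻¹ y^k`. -/
def powWord (x y : Letter) (k : ℕ) : List (Letter × Bool) :=
  (x, false) :: List.replicate k (y, true)

/-- The word `t_i⁻¹ ȧ_{n,0} t_i ḃ_{n,0}⁻¹`. -/
def conjWord (i n : ℕ+) : List (Letter × Bool) :=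
  [(.t i, false), (.a n 0, true), (.t i, true), (.b n 0, false)]

/-- The defining relators of `Ġ`, as words: `Ȧ_n` and `Ḃ_n` are abelian, the relations of the
`Ȧ_n`, those of the `Ḃ_n`, and the relations `t_i⁻¹ ȧ_{n_i,0} t_i = ḃ_{n_i,0}`. -/
def relatorWords : Set (List (Letter × Bool)) :=
  {w | (∃ n : ℕ+, w = commWord (.a n 0) (.a n 1)) ∨
    (∃ n : ℕ+, w = commWord (.b n 0) (.b n 1)) ∨
    (∃ i : ℕ+, w = powWord (.a (ν i) 1) (.a (ν i) 0) (2 ^ (i : ℕ))) ∨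
    (∃ i : ℕ+, w = powWord (.a (μ i) 1) (.a (μ i) 0) (3 ^ (i : ℕ))) ∨
    (∃ i : ℕ+, w = powWord (.b (ν i) 1) (.b (ν i) 0) (2 ^ (i : ℕ))) ∨
    (∃ i : ℕ+, w = powWord (.b (μ i) 1) (.b (μ i) 0) (2 ^ (i : ℕ))) ∨
    (∃ i : ℕ+, w = conjWord i (ν i))}

end DotGroup

/-! For `n = n_i` the second generators of `Ȧ_n` and `Ḃ_n` are both the `2^i`-th powers of the
first, so conjugation by `t_i` carries all of `Ȧ_n` onto `Ḃ_n`. Hence `Ḃ_{n_i}` is redundant, and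
`Ġ` is the free product of all `Ȧ_n`, the `Ḃ_n` with `n` outside the range of `ν`, and the `⟨t_i⟩`.
Two obstacles remain, because that range need not be decidable.

Triviality inside a factor: exponents `(x, y)` are killed by `x_1 = c^i x_0` only if `x + c^i y =
0`, and if `y ≠ 0` this forces `i < c^i ≤ |x|`. So only finitely many `i` need be tried, without
knowing whether `n` is enumerated (`quotientTest_iff`).

Elimination of `Ḃ_{n_i}`: it suffices to replace `b_{n_i,m}` by `t_i⁻¹ a_{n_i,m} t_i` for those `i`
for which `t_i` occurs in the word. If `t_i` does not occur, a remaining syllable from `Ḃ_{n_i}`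
still stands for some `t_i⁻¹ a t_i`, but its outer letters `t_i` meet nothing that could cancel
them.

The resulting syllables are reduced as in a free product. Reduction preserves the value
(`listValue_normalForm`). Conversely, `Ġ` maps to a free product of copies of `ℤ × ℤ`, where a
nonempty reduced list becomes a nonempty reduced word (`exists_neWord_listValue`), hence not `1`. So
a word is trivial iff its normal form is empty (`wordValue_eq_one_iff`), and the normal form is
computable (`computable_normalForm`). -/

namespace DotGroup

/-! ### Values of words. -/

section words

variable {X G : Type*} [Group G] (g : X → G)

@[simp] theorem wordValue_nil : wordValue g [] = 1 := by
  simp [wordValue]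

@[simp] theorem wordValue_cons_true (x : X) (w : List (X × Bool)) :
    wordValue g ((x, true) :: w) = g x * wordValue g w := by
  simp [wordValue, FreeGroup.lift_mk]

@[simp] theorem wordValue_cons_false (x : X) (w : List (X × Bool)) :
    wordValue g ((x, false) :: w) = (g x)⁻¹ * wordValue g w := by
  simp [wordValue, FreeGroup.lift_mk]

@[simp] theorem wordValue_replicate (x : X) (k : ℕ) :
    wordValue g (List.replicate k (x, true)) = g x ^ k := by
  simp [wordValue, FreeGroup.lift_mk]

theorem wordValue_append (v w : List (X × Bool)) :
    wordValue g (v ++ w) = wordValue g v * wordValue g w := by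
  simp [wordValue, FreeGroup.lift_mk]

theorem wordValue_invRev (w : List (X × Bool)) :
    wordValue g (FreeGroup.invRev w) = (wordValue g w)⁻¹ := by
  rw [wordValue, ← FreeGroup.inv_mk, map_inv, wordValue]

end words

/-! ### The universal property of `Ġ` and its presentation. -/

/-- The elements `g x` of `K` satisfy the defining relations of `Ġ`. -/
structure Satisfies (ν μ : ℕ+ → ℕ+) {K : Type*} [Group K] (g : Letter → K) : Prop where
  commute_a : ∀ n, Commute (g (.a n 0)) (g (.a n 1))
  commute_b : ∀ n, Commute (g (.b n 0)) (g (.b n 1))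
  pow_a_left : ∀ i : ℕ+, g (.a (ν i) 1) = g (.a (ν i) 0) ^ (2 ^ (i : ℕ))
  pow_a_right : ∀ i : ℕ+, g (.a (μ i) 1) = g (.a (μ i) 0) ^ (3 ^ (i : ℕ))
  pow_b_left : ∀ i : ℕ+, g (.b (ν i) 1) = g (.b (ν i) 0) ^ (2 ^ (i : ℕ))
  pow_b_right : ∀ i : ℕ+, g (.b (μ i) 1) = g (.b (μ i) 0) ^ (2 ^ (i : ℕ))
  conj : ∀ i : ℕ+, (g (.t i))⁻¹ * g (.a (ν i) 0) * g (.t i) = g (.b (ν i) 0)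

theorem wordValue_commWord {K : Type*} [Group K] (g : Letter → K) (x y : Letter) :
    wordValue g (commWord x y) = 1 ↔ Commute (g x) (g y) := by
  rw [← commutatorElement_eq_one_iff_commute, commutatorElement_def]
  simp [commWord, mul_assoc]

theorem wordValue_powWord {K : Type*} [Group K] (g : Letter → K) (x y : Letter) (k : ℕ) :
    wordValue g (powWord x y k) = 1 ↔ g x = g y ^ k := by
  simp [powWord, inv_mul_eq_one]

theorem wordValue_conjWord {K : Type*} [Group K] (g : Letter → K) (i n : ℕ+) :
    wordValue g (conjWord i n) = 1 ↔ (g (.t i))⁻¹ * g (.a n 0) * g (.t i) = g (.b n 0) := by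
  rw [← mul_inv_eq_one (b := g (.b n 0))]
  simp [conjWord, mul_assoc]

variable (ν μ : ℕ+ → ℕ+)

theorem satisfies_iff {K : Type*} [Group K] (g : Letter → K) :
    Satisfies ν μ g ↔ ∀ w ∈ relatorWords ν μ, wordValue g w = 1 := by
  constructor
  · rintro ⟨h₁, h₂, h₃, h₄, h₅, h₆, h₇⟩ w
    rintro (⟨n, rfl⟩ | ⟨n, rfl⟩ | ⟨i, rfl⟩ | ⟨i, rfl⟩ | ⟨i, rfl⟩ | ⟨i, rfl⟩ | ⟨i, rfl⟩)
    · exact (wordValue_commWord g _ _).2 (h₁ n)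
    · exact (wordValue_commWord g _ _).2 (h₂ n)
    · exact (wordValue_powWord g _ _ _).2 (h₃ i)
    · exact (wordValue_powWord g _ _ _).2 (h₄ i)
    · exact (wordValue_powWord g _ _ _).2 (h₅ i)
    · exact (wordValue_powWord g _ _ _).2 (h₆ i)
    · exact (wordValue_conjWord g _ _).2 (h₇ i)
  · intro h
    exact
      { commute_a := fun n => (wordValue_commWord g _ _).1 (h _ (.inl ⟨n, rfl⟩))
        commute_b := fun n => (wordValue_commWord g _ _).1 (h _ (.inr (.inl ⟨n, rfl⟩)))
        pow_a_left := fun i => (wordValue_powWord g _ _ _).1 (h _ (.inr (.inr (.inl ⟨i, rfl⟩))))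
        pow_a_right := fun i =>
          (wordValue_powWord g _ _ _).1 (h _ (.inr (.inr (.inr (.inl ⟨i, rfl⟩)))))
        pow_b_left := fun i =>
          (wordValue_powWord g _ _ _).1 (h _ (.inr (.inr (.inr (.inr (.inl ⟨i, rfl⟩))))))
        pow_b_right := fun i =>
          (wordValue_powWord g _ _ _).1 (h _ (.inr (.inr (.inr (.inr (.inr (.inl ⟨i, rfl⟩)))))))
        conj := fun i =>
          (wordValue_conjWord g _ _).1 (h _ (.inr (.inr (.inr (.inr (.inr (.inr ⟨i, rfl⟩))))))) }

/-- The homomorphism from the free abelian group of rank two defined by two commuting elements. -/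
def pairHom {K : Type*} [Group K] {p q : K} (h : Commute p q) : FreeAb →+ Additive K where
  toFun v := Additive.ofMul (p ^ v 0 * q ^ v 1)
  map_zero' := by simp
  map_add' v w := by
    rw [← ofMul_mul, Pi.add_apply, Pi.add_apply, zpow_add, zpow_add]
    congr 1
    simp only [mul_assoc]
    rw [← mul_assoc (p ^ w 0), ((h.zpow_zpow (w 0) (v 1))).eq, mul_assoc]

theorem pairHom_apply {K : Type*} [Group K] {p q : K} (h : Commute p q) (v : FreeAb) :
    pairHom h v = Additive.ofMul (p ^ v 0 * q ^ v 1) := rfl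

theorem pairHom_rel {K : Type*} [Group K] {p q : K} (h : Commute p q) {k : ℕ} (hk : q = p ^ k) :
    pairHom h (basisVec 1 - (k : ℤ) • basisVec 0) = 0 := by
  rw [pairHom_apply, ofMul_eq_zero]
  simp [basisVec, hk]

theorem pairHom_basisVec {K : Type*} [Group K] {g : Fin 2 → K} (h : Commute (g 0) (g 1))
    (m : Fin 2) : pairHom h (basisVec m) = Additive.ofMul (g m) := by
  rw [pairHom_apply]
  fin_cases m <;> simp [basisVec]

/-- The universal property. It is applied to the abstractly presented group, to identify the kernel,
and to `Target`, to detect nontrivial elements. -/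
theorem exists_lift {K : Type*} [Group K] {g : Letter → K} (h : Satisfies ν μ g) :
    ∃ f : GDot ν μ →* K, ∀ x, f (generator ν μ x) = g x := by
  have hA : ∀ n, AddSubgroup.closure (relA ν μ n) ≤ (pairHom (h.commute_a n)).ker := by
    intro n
    rw [AddSubgroup.closure_le]
    rintro _ (⟨i, rfl, rfl⟩ | ⟨i, rfl, rfl⟩)
    · exact_mod_cast pairHom_rel _ (h.pow_a_left i)
    · exact_mod_cast pairHom_rel _ (h.pow_a_right i)
  have hB : ∀ n, AddSubgroup.closure (relB ν μ n) ≤ (pairHom (h.commute_b n)).ker := by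
    intro n
    rw [AddSubgroup.closure_le]
    rintro _ ⟨i, rfl | rfl, rfl⟩
    · exact_mod_cast pairHom_rel _ (h.pow_b_left i)
    · exact_mod_cast pairHom_rel _ (h.pow_b_right i)
  let fA : AProd ν μ →* K := Monoid.CoprodI.lift fun n =>
    AddMonoidHom.toMultiplicativeLeft (QuotientAddGroup.lift _ (pairHom (h.commute_a n)) (hA n))
  let fB : BProd ν μ →* K := Monoid.CoprodI.lift fun n =>
    AddMonoidHom.toMultiplicativeLeft (QuotientAddGroup.lift _ (pairHom (h.commute_b n)) (hB n))
  let f : FreeProd ν μ →* K :=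
    Monoid.Coprod.lift (Monoid.Coprod.lift fA fB) (FreeGroup.lift fun i => g (.t i))
  have fa : ∀ n m, f (aElt ν μ n m) = g (.a n m) := by
    intro n m
    have : fA (Monoid.CoprodI.of (i := n)
      (Multiplicative.ofAdd (QuotientAddGroup.mk (basisVec m) : ADot ν μ n))) = g (.a n m) := by
      refine (Monoid.CoprodI.lift_of _ _).trans ?_
      exact congrArg Additive.toMul (pairHom_basisVec (g := fun m => g (.a n m)) (h.commute_a n) m)
    refine Eq.trans ?_ this
    simp only [f, aElt, Monoid.Coprod.lift_apply_inl]
    exact Monoid.Coprod.lift_apply_inl fA fB _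
  have fb : ∀ n m, f (bElt ν μ n m) = g (.b n m) := by
    intro n m
    have : fB (Monoid.CoprodI.of (i := n)
      (Multiplicative.ofAdd (QuotientAddGroup.mk (basisVec m) : BDot ν μ n))) = g (.b n m) := by
      refine (Monoid.CoprodI.lift_of _ _).trans ?_
      exact congrArg Additive.toMul (pairHom_basisVec (g := fun m => g (.b n m)) (h.commute_b n) m)
    refine Eq.trans ?_ this
    simp only [f, bElt, Monoid.Coprod.lift_apply_inl]
    exact Monoid.Coprod.lift_apply_inr fA fB _
  have ft : ∀ i, f (tElt ν μ i) = g (.t i) := by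
    intro i
    simp [f, tElt]
  have hker : Subgroup.normalClosure (conjRelators ν μ) ≤ f.ker := by
    refine Subgroup.normalClosure_le_normal ?_
    rintro _ ⟨i, rfl⟩
    change f _ = 1
    rw [map_mul, map_mul, map_mul, map_inv, map_inv, fa, fb, ft, mul_inv_eq_one]
    exact h.conj i
  refine ⟨QuotientGroup.lift _ f hker, ?_⟩
  rintro (⟨n, m⟩ | ⟨n, m⟩ | i)
  · exact fa n m
  · exact fb n m
  · exact ft i

/-- The canonical homomorphism from the free product of the `Ȧ_n` to `Ġ`. -/
def aProdHom : (Monoid.CoprodI fun n : ℕ+ => Multiplicative (ADot ν μ n)) →* GDot ν μ :=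
  (QuotientGroup.mk' (Subgroup.normalClosure (conjRelators ν μ))).comp <|
    (Monoid.Coprod.inl : GDotZero ν μ →* FreeProd ν μ).comp
      (Monoid.Coprod.inl : AProd ν μ →* GDotZero ν μ)

/-- The canonical homomorphism from `FreeAb` through `Ȧ_n` to `Ġ`. -/
def aHom (n : ℕ+) : Multiplicative FreeAb →* GDot ν μ :=
  ((aProdHom ν μ).comp
    (Monoid.CoprodI.of (M := fun n : ℕ+ => Multiplicative (ADot ν μ n)) (i := n))).comp <|
    AddMonoidHom.toMultiplicative (QuotientAddGroup.mk' _)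

/-- The canonical homomorphism from the free product of the `Ḃ_n` to `Ġ`. -/
def bProdHom : (Monoid.CoprodI fun n : ℕ+ => Multiplicative (BDot ν μ n)) →* GDot ν μ :=
  (QuotientGroup.mk' (Subgroup.normalClosure (conjRelators ν μ))).comp <|
    (Monoid.Coprod.inl : GDotZero ν μ →* FreeProd ν μ).comp
      (Monoid.Coprod.inr : BProd ν μ →* GDotZero ν μ)

/-- The canonical homomorphism from `FreeAb` through `Ḃ_n` to `Ġ`. -/
def bHom (n : ℕ+) : Multiplicative FreeAb →* GDot ν μ :=
  ((bProdHom ν μ).comp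
    (Monoid.CoprodI.of (M := fun n : ℕ+ => Multiplicative (BDot ν μ n)) (i := n))).comp <|
    AddMonoidHom.toMultiplicative (QuotientAddGroup.mk' _)

theorem aHom_basisVec (n : ℕ+) (m : Fin 2) :
    aHom ν μ n (Multiplicative.ofAdd (basisVec m)) = generator ν μ (.a n m) := rfl

theorem bHom_basisVec (n : ℕ+) (m : Fin 2) :
    bHom ν μ n (Multiplicative.ofAdd (basisVec m)) = generator ν μ (.b n m) := rfl

theorem aHom_eq_one {n : ℕ+} {v : FreeAb} (hv : v ∈ AddSubgroup.closure (relA ν μ n)) :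
    aHom ν μ n (Multiplicative.ofAdd v) = 1 := by
  have : (QuotientAddGroup.mk v : ADot ν μ n) = 0 := (QuotientAddGroup.eq_zero_iff v).2 hv
  refine (congrArg (fun y : ADot ν μ n => ((aProdHom ν μ).comp (Monoid.CoprodI.of
    (M := fun n : ℕ+ => Multiplicative (ADot ν μ n)) (i := n))) (Multiplicative.ofAdd y))
    this).trans ?_
  rw [ofAdd_zero, map_one]

theorem bHom_eq_one {n : ℕ+} {v : FreeAb} (hv : v ∈ AddSubgroup.closure (relB ν μ n)) :
    bHom ν μ n (Multiplicative.ofAdd v) = 1 := by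
  have : (QuotientAddGroup.mk v : BDot ν μ n) = 0 := (QuotientAddGroup.eq_zero_iff v).2 hv
  refine (congrArg (fun y : BDot ν μ n => ((bProdHom ν μ).comp (Monoid.CoprodI.of
    (M := fun n : ℕ+ => Multiplicative (BDot ν μ n)) (i := n))) (Multiplicative.ofAdd y))
    this).trans ?_
  rw [ofAdd_zero, map_one]

theorem eq_pow_of_map_rel {K : Type*} [Group K] (f : Multiplicative FreeAb →* K) (k : ℕ)
    (h : f (Multiplicative.ofAdd (basisVec 1 - (k : ℤ) • basisVec 0)) = 1) :
    f (Multiplicative.ofAdd (basisVec 1)) = f (Multiplicative.ofAdd (basisVec 0)) ^ k := by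
  rw [ofAdd_sub, map_div, ofAdd_zsmul, map_zpow, div_eq_one, zpow_natCast] at h
  exact h

theorem satisfies_generator : Satisfies ν μ (generator ν μ) where
  commute_a n := by
    rw [← aHom_basisVec, ← aHom_basisVec]
    exact (Commute.all _ _).map _
  commute_b n := by
    rw [← bHom_basisVec, ← bHom_basisVec]
    exact (Commute.all _ _).map _
  pow_a_left i := by
    refine eq_pow_of_map_rel (aHom ν μ (ν i)) _ (aHom_eq_one ν μ (AddSubgroup.subset_closure ?_))
    exact .inl ⟨i, rfl, by simp⟩
  pow_a_right i := by
    refine eq_pow_of_map_rel (aHom ν μ (μ i)) _ (aHom_eq_one ν μ (AddSubgroup.subset_closure ?_))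
    exact .inr ⟨i, rfl, by simp⟩
  pow_b_left i := by
    refine eq_pow_of_map_rel (bHom ν μ (ν i)) _ (bHom_eq_one ν μ (AddSubgroup.subset_closure ?_))
    exact ⟨i, .inl rfl, by simp⟩
  pow_b_right i := by
    refine eq_pow_of_map_rel (bHom ν μ (μ i)) _ (bHom_eq_one ν μ (AddSubgroup.subset_closure ?_))
    exact ⟨i, .inr rfl, by simp⟩
  conj i := by
    rw [← mul_inv_eq_one]
    exact (QuotientGroup.eq_one_iff _).2 (Subgroup.subset_normalClosure ⟨i, rfl⟩)

theorem lift_generator_surjective : Function.Surjective (FreeGroup.lift (generator ν μ)) := by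
  rw [← MonoidHom.range_eq_top, eq_top_iff]
  intro x _
  set H := (FreeGroup.lift (generator ν μ)).range
  have hmem : ∀ l, generator ν μ l ∈ H := fun l => ⟨FreeGroup.of l, by simp⟩
  -- `FreeAb` is generated by its basis, so a homomorphism on it need only be checked there; this
  -- serves for `aHom` and `bHom` alike.
  have key : ∀ f : Multiplicative FreeAb →* GDot ν μ,
      (∀ m, f (Multiplicative.ofAdd (basisVec m)) ∈ H) → ∀ v, f v ∈ H := by
    intro f hf v
    have : v = Multiplicative.ofAdd (basisVec 0) ^ (v.toAdd 0) *
        Multiplicative.ofAdd (basisVec 1) ^ (v.toAdd 1) := by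
      rw [← ofAdd_zsmul, ← ofAdd_zsmul, ← ofAdd_add]
      apply Multiplicative.toAdd.injective
      funext j
      fin_cases j <;> simp [basisVec]
    rw [this, map_mul, map_zpow, map_zpow]
    exact mul_mem (zpow_mem (hf 0) _) (zpow_mem (hf 1) _)
  obtain ⟨x, rfl⟩ := QuotientGroup.mk_surjective x
  induction x using Monoid.Coprod.induction_on with
  | inl x =>
    induction x using Monoid.Coprod.induction_on with
    | inl x =>
      have hx : ∀ x, aProdHom ν μ x ∈ H := by
        intro x
        induction x using Monoid.CoprodI.induction_on with
        | one => rw [map_one]; exact one_mem H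
        | of n v =>
          obtain ⟨v, rfl⟩ := QuotientAddGroup.mk_surjective v
          exact key (aHom ν μ n) (fun m => hmem (.a n m)) (Multiplicative.ofAdd v)
        | mul x y hx hy => rw [map_mul]; exact mul_mem hx hy
      exact hx x
    | inr x =>
      have hx : ∀ x, bProdHom ν μ x ∈ H := by
        intro x
        induction x using Monoid.CoprodI.induction_on with
        | one => rw [map_one]; exact one_mem H
        | of n v =>
          obtain ⟨v, rfl⟩ := QuotientAddGroup.mk_surjective v
          exact key (bHom ν μ n) (fun m => hmem (.b n m)) (Multiplicative.ofAdd v)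
        | mul x y hx hy => rw [map_mul]; exact mul_mem hx hy
      exact hx x
    | mul x y hx hy =>
      rw [map_mul]
      exact mul_mem (hx trivial) (hy trivial)
  | inr x =>
    induction x using FreeGroup.induction_on with
    | C1 => rw [map_one]; exact one_mem H
    | of i => exact hmem (.t i)
    | inv_of i hi => exact inv_mem (hi trivial)
    | mul x y hx hy =>
      rw [map_mul]
      exact mul_mem (hx trivial) (hy trivial)
  | mul x y hx hy => exact mul_mem (hx trivial) (hy trivial)

/-- The universal property sends `Ġ` back to the abstractly presented group, and the composite from
the free group is the quotient map; so whatever dies in `Ġ` already lies in the normal closure. -/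
theorem ker_lift_generator : (FreeGroup.lift (generator ν μ)).ker =
    Subgroup.normalClosure (FreeGroup.mk '' relatorWords ν μ) := by
  apply le_antisymm
  · set N := Subgroup.normalClosure (FreeGroup.mk '' relatorWords ν μ)
    have hlift : FreeGroup.lift (fun x => (FreeGroup.of x : FreeGroup Letter ⧸ N)) =
        QuotientGroup.mk' N := by
      ext x
      simp
    obtain ⟨f, hf⟩ := exists_lift ν μ (K := FreeGroup Letter ⧸ N)
      (g := fun x => (FreeGroup.of x : FreeGroup Letter ⧸ N)) <| by
        rw [satisfies_iff]
        intro w hw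
        rw [wordValue, hlift]
        exact (QuotientGroup.eq_one_iff _).2 (Subgroup.subset_normalClosure ⟨w, hw, rfl⟩)
    have hcomp : f.comp (FreeGroup.lift (generator ν μ)) = QuotientGroup.mk' N := by
      ext x
      simp [hf]
    intro x hx
    rw [← QuotientGroup.ker_mk' N, ← hcomp, MonoidHom.mem_ker, MonoidHom.comp_apply,
      MonoidHom.mem_ker.1 hx, map_one]
  · refine Subgroup.normalClosure_le_normal ?_
    rintro _ ⟨w, hw, rfl⟩
    exact (satisfies_iff ν μ _).1 (satisfies_generator ν μ) w hw

/-! ### Syllables and the decision of triviality in one factor. -/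

/-- The index set of the free factors: the `Ȧ_n`, the `Ḃ_n`, and the `⟨t_i⟩`. -/
abbrev Index : Type := ℕ+ ⊕ ℕ+ ⊕ ℕ+

/-- Two integer exponents, each given as a formal difference of natural numbers. -/
abbrev Coeff : Type := (ℕ × ℕ) × (ℕ × ℕ)

/-- The first exponent. -/
def Coeff.x (v : Coeff) : ℤ := (v.1.1 : ℤ) - v.1.2

/-- The second exponent. -/
def Coeff.y (v : Coeff) : ℤ := (v.2.1 : ℤ) - v.2.2

theorem Coeff.x_add (v w : Coeff) : Coeff.x (v + w) = Coeff.x v + Coeff.x w := by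
  simp [Coeff.x]; ring

theorem Coeff.y_add (v w : Coeff) : Coeff.y (v + w) = Coeff.y v + Coeff.y w := by
  simp [Coeff.y]; ring

/-- An element of a free factor, given by exponents on the generators. -/
abbrev Syllable : Type := Index × Coeff

/-- The element represented by a syllable. -/
def syllableValue {K : Type*} [Group K] (g : Letter → K) : Syllable → K
  | (.inl n, v) => g (.a n 0) ^ Coeff.x v * g (.a n 1) ^ Coeff.y v
  | (.inr (.inl n), v) => g (.b n 0) ^ Coeff.x v * g (.b n 1) ^ Coeff.y v
  | (.inr (.inr i), v) => g (.t i) ^ Coeff.x v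

/-- The element represented by a list of syllables. -/
def listValue {K : Type*} [Group K] (g : Letter → K) (L : List Syllable) : K :=
  (L.map (syllableValue g)).prod

/-- The test whether `n = f (i + 1)` and `x + c ^ (i + 1) * y = 0`. -/
def relationTest (c : ℕ) (f : ℕ+ → ℕ+) (n : ℕ+) (v : Coeff) (i : ℕ) : Bool :=
  (f i.succPNat == n) && (v.1.1 + c ^ (i + 1) * v.2.1 == v.1.2 + c ^ (i + 1) * v.2.2)

/-- The test whether the exponents `v` define the trivial element of the quotient of the free
abelian group of rank two by the relation with base `2` if `n = n_i`, and base `c` if `n = m_i`. -/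
def quotientTest (c : ℕ) (n : ℕ+) (v : Coeff) : Bool :=
  ((v.1.1 == v.1.2) && (v.2.1 == v.2.2)) ||
    (List.range (v.1.1 + v.1.2)).any fun i => relationTest 2 ν n v i || relationTest c μ n v i

/-- The test whether a syllable represents the trivial element. -/
def trivialTest (s : Syllable) : Bool :=
  match s.1 with
  | .inl n => quotientTest ν μ 3 n s.2
  | .inr (.inl n) => quotientTest ν μ 2 n s.2
  | .inr (.inr _) => s.2.1.1 == s.2.1.2

/-- Moving the negative parts across the equation turns the integer relation into an equality of
natural numbers. The search variable starts at `0`, so it stands for the index `i + 1`. -/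
theorem relationTest_iff (c : ℕ) (f : ℕ+ → ℕ+) (n : ℕ+) (v : Coeff) (i : ℕ) :
    relationTest c f n v i = true ↔
      f i.succPNat = n ∧ Coeff.x v + (c : ℤ) ^ (i.succPNat : ℕ) * Coeff.y v = 0 := by
  simp only [relationTest, Bool.and_eq_true, beq_iff_eq, Coeff.x, Coeff.y, Nat.succPNat_coe,
    Nat.succ_eq_add_one]
  refine and_congr_right fun _ => ?_
  rw [← @Nat.cast_inj ℤ]
  push_cast
  constructor <;> intro h <;> linarith

/-- The bounded search loses nothing: a solution with exponents not both zero has `y ≠ 0`, so `i < d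
^ i ≤ |x|` for the base `d ≥ 2` concerned, and `|x|` is at most the sum of the two natural numbers
whose difference is `x`. -/
theorem quotientTest_iff {c : ℕ} (hc : 2 ≤ c) (n : ℕ+) (v : Coeff) :
    quotientTest ν μ c n v = true ↔ (Coeff.x v = 0 ∧ Coeff.y v = 0) ∨
      (∃ i : ℕ+, ν i = n ∧ Coeff.x v + 2 ^ (i : ℕ) * Coeff.y v = 0) ∨
      ∃ i : ℕ+, μ i = n ∧ Coeff.x v + (c : ℤ) ^ (i : ℕ) * Coeff.y v = 0 := by
  have hzero : ((v.1.1 == v.1.2) && (v.2.1 == v.2.2)) = true ↔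
      Coeff.x v = 0 ∧ Coeff.y v = 0 := by
    simp only [Bool.and_eq_true, beq_iff_eq, Coeff.x, Coeff.y]
    omega
  have hbound : ∀ {d : ℕ}, 2 ≤ d → ∀ i : ℕ+, ¬ (Coeff.x v = 0 ∧ Coeff.y v = 0) →
      Coeff.x v + (d : ℤ) ^ (i : ℕ) * Coeff.y v = 0 → i.natPred < v.1.1 + v.1.2 := by
    intro d hd i h0 h
    have hy : Coeff.y v ≠ 0 := by
      intro hy
      rw [hy, mul_zero, add_zero] at h
      exact h0 ⟨h, hy⟩
    have h1 : (Coeff.x v).natAbs = d ^ (i : ℕ) * (Coeff.y v).natAbs := by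
      rw [eq_neg_of_add_eq_zero_left h, Int.natAbs_neg, Int.natAbs_mul, Int.natAbs_pow,
        Int.natAbs_natCast]
    have h2 : (i : ℕ) < d ^ (i : ℕ) := Nat.lt_pow_self hd
    have h3 : d ^ (i : ℕ) ≤ (Coeff.x v).natAbs := by
      rw [h1]
      exact Nat.le_mul_of_pos_right _ (Int.natAbs_pos.2 hy)
    have h4 : (Coeff.x v).natAbs ≤ v.1.1 + v.1.2 := by
      simp only [Coeff.x]
      omega
    have h5 : i.natPred ≤ (i : ℕ) := by
      rw [PNat.natPred]; omega
    omega
  rw [quotientTest, Bool.or_eq_true, hzero]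
  by_cases h0 : Coeff.x v = 0 ∧ Coeff.y v = 0
  · simp only [h0, and_self, true_or]
  simp only [h0, false_or, List.any_eq_true, List.mem_range, Bool.or_eq_true, relationTest_iff]
  constructor
  · rintro ⟨i, -, h | h⟩
    · exact .inl ⟨_, by exact_mod_cast h⟩
    · exact .inr ⟨_, h⟩
  · rintro (⟨i, hi, h⟩ | ⟨i, hi, h⟩)
    · refine ⟨i.natPred, hbound le_rfl i h0 (by exact_mod_cast h), .inl ?_⟩
      rw [PNat.succPNat_natPred]
      exact ⟨hi, by exact_mod_cast h⟩
    · refine ⟨i.natPred, hbound hc i h0 h, .inr ?_⟩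
      rw [PNat.succPNat_natPred]
      exact ⟨hi, h⟩

section value

variable {K : Type*} [Group K] {g : Letter → K}

theorem map_syllableValue {H : Type*} [Group H] (f : K →* H) (s : Syllable) :
    f (syllableValue g s) = syllableValue (fun x => f (g x)) s := by
  obtain ⟨_ | _ | _, v⟩ := s <;> simp [syllableValue]

theorem map_listValue {H : Type*} [Group H] (f : K →* H) (L : List Syllable) :
    f (listValue g L) = listValue (fun x => f (g x)) L := by
  simp [listValue, map_list_prod, Function.comp_def, map_syllableValue]

@[simp] theorem listValue_nil : listValue g [] = 1 := rfl

@[simp] theorem listValue_cons (s : Syllable) (L : List Syllable) :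
    listValue g (s :: L) = syllableValue g s * listValue g L := by
  simp [listValue]

theorem listValue_append (L L' : List Syllable) :
    listValue g (L ++ L') = listValue g L * listValue g L' := by
  simp [listValue]

theorem commute_zpow_mul {p q : K} (h : Commute p q) (x y x' y' : ℤ) :
    p ^ (x + x') * q ^ (y + y') = p ^ x * q ^ y * (p ^ x' * q ^ y') := by
  rw [zpow_add, zpow_add]
  simp only [mul_assoc]
  rw [← mul_assoc (p ^ x'), (h.zpow_zpow x' y).eq, mul_assoc]

theorem zpow_mul_zpow_eq_one {p q : K} {k : ℕ} (h : q = p ^ k) {x y : ℤ}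
    (hxy : x + (k : ℤ) * y = 0) : p ^ x * q ^ y = 1 := by
  rw [h, ← zpow_natCast, ← zpow_mul, ← zpow_add, hxy, zpow_zero]

variable {ν μ}

theorem syllableValue_add (hg : Satisfies ν μ g) (k : Index) (v w : Coeff) :
    syllableValue g (k, v + w) = syllableValue g (k, v) * syllableValue g (k, w) := by
  obtain n | n | i := k
  · simp only [syllableValue, Coeff.x_add, Coeff.y_add]
    exact commute_zpow_mul (hg.commute_a n) _ _ _ _
  · simp only [syllableValue, Coeff.x_add, Coeff.y_add]
    exact commute_zpow_mul (hg.commute_b n) _ _ _ _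
  · simp only [syllableValue, Coeff.x_add, zpow_add]

/-- Soundness of the test in every group satisfying the relations. Its completeness is seen in
`Target`, through `coeffVec_ne_zero`. -/
theorem syllableValue_eq_one (hg : Satisfies ν μ g) {s : Syllable} (h : trivialTest ν μ s = true) :
    syllableValue g s = 1 := by
  obtain ⟨n | n | i, v⟩ := s
  · rcases (quotientTest_iff ν μ (by norm_num) n v).1 h with
      ⟨hx, hy⟩ | ⟨i, rfl, hi⟩ | ⟨i, rfl, hi⟩
    · simp [syllableValue, hx, hy]
    · exact zpow_mul_zpow_eq_one (hg.pow_a_left i) (by exact_mod_cast hi)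
    · exact zpow_mul_zpow_eq_one (hg.pow_a_right i) (by exact_mod_cast hi)
  · rcases (quotientTest_iff ν μ le_rfl n v).1 h with
      ⟨hx, hy⟩ | ⟨i, rfl, hi⟩ | ⟨i, rfl, hi⟩
    · simp [syllableValue, hx, hy]
    · exact zpow_mul_zpow_eq_one (hg.pow_b_left i) (by exact_mod_cast hi)
    · exact zpow_mul_zpow_eq_one (hg.pow_b_right i) (by exact_mod_cast hi)
  · have hx : Coeff.x v = 0 := by
      have : v.1.1 = v.1.2 := beq_iff_eq.1 h
      simp [Coeff.x, this]
    simp [syllableValue, hx]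

end value

/-! ### Reduction of lists of syllables. -/

/-- Prepend a syllable, unless it is trivial. -/
def consNontrivial (s : Syllable) (L : List Syllable) : List Syllable :=
  bif trivialTest ν μ s then L else s :: L

/-- Multiply a reduced list of syllables by a syllable on the left. -/
def mulSyllable (s : Syllable) : List Syllable → List Syllable
  | [] => consNontrivial ν μ s []
  | s' :: L =>
    bif decide (s'.1 = s.1) then consNontrivial ν μ (s.1, s.2 + s'.2) L
    else consNontrivial ν μ s (s' :: L)

/-- The reduced form of a list of syllables. -/
def reduceList (L : List Syllable) : List Syllable :=
  L.foldr (mulSyllable ν μ) []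

/-- A list of nontrivial syllables, in which neighbours belong to different factors. -/
def IsReduced (L : List Syllable) : Prop :=
  L.IsChain (fun s s' => s.1 ≠ s'.1) ∧ ∀ s ∈ L, trivialTest ν μ s = false

section reduce

variable {ν μ}

theorem IsReduced.tail {s : Syllable} {L : List Syllable} (h : IsReduced ν μ (s :: L)) :
    IsReduced ν μ L :=
  ⟨h.1.tail, fun s' hs' => h.2 s' (List.mem_cons_of_mem _ hs')⟩

theorem IsReduced.consNontrivial {s : Syllable} {L : List Syllable} (h : IsReduced ν μ L)
    (hs : ∀ s' ∈ L.head?, s.1 ≠ s'.1) : IsReduced ν μ (consNontrivial ν μ s L) := by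
  rw [DotGroup.consNontrivial]
  cases ht : trivialTest ν μ s with
  | true => exact h
  | false =>
    refine ⟨List.isChain_cons.2 ⟨hs, h.1⟩, ?_⟩
    intro s' hs'
    rcases List.mem_cons.1 hs' with rfl | hs'
    exacts [ht, h.2 s' hs']

/-- If the first two indices agree, the merged syllable either vanishes, leaving a reduced tail, or
takes the place of the old head, with the same index and hence the same admissible neighbour. -/
theorem IsReduced.mulSyllable {L : List Syllable} (h : IsReduced ν μ L) (s : Syllable) :
    IsReduced ν μ (mulSyllable ν μ s L) := by
  cases L with
  | nil => exact h.consNontrivial (by simp)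
  | cons s' L =>
    rw [DotGroup.mulSyllable]
    by_cases hs : s'.1 = s.1
    · rw [decide_eq_true hs]
      refine h.tail.consNontrivial ?_
      rw [← hs]
      exact (List.isChain_cons.1 h.1).1
    · rw [decide_eq_false hs]
      exact h.consNontrivial (by simpa using fun h => hs h.symm)

theorem isReduced_reduceList (L : List Syllable) : IsReduced ν μ (reduceList ν μ L) := by
  induction L with
  | nil => exact ⟨List.isChain_nil, by simp [reduceList]⟩
  | cons s L ih => exact ih.mulSyllable s

theorem forall_mem_consNontrivial {P : Index → Prop} {s : Syllable} {L : List Syllable}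
    (hs : P s.1) (hL : ∀ s ∈ L, P s.1) : ∀ s' ∈ consNontrivial ν μ s L, P s'.1 := by
  rw [consNontrivial]
  cases trivialTest ν μ s with
  | true => exact hL
  | false => exact List.forall_mem_cons.2 ⟨hs, hL⟩

theorem forall_mem_mulSyllable {P : Index → Prop} {s : Syllable} {L : List Syllable}
    (hs : P s.1) (hL : ∀ s ∈ L, P s.1) : ∀ s' ∈ mulSyllable ν μ s L, P s'.1 := by
  cases L with
  | nil => exact forall_mem_consNontrivial hs hL
  | cons s' L =>
    rw [mulSyllable]
    cases decide (s'.1 = s.1) with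
    | true =>
      exact forall_mem_consNontrivial hs fun x hx => hL x (List.mem_cons_of_mem _ hx)
    | false => exact forall_mem_consNontrivial hs hL

/-- Reduction creates no new index, so admissibility of the indices survives it. -/
theorem forall_mem_reduceList {P : Index → Prop} {L : List Syllable} (hL : ∀ s ∈ L, P s.1) :
    ∀ s ∈ reduceList ν μ L, P s.1 := by
  induction L with
  | nil => exact hL
  | cons s L ih =>
    rw [List.forall_mem_cons] at hL
    exact forall_mem_mulSyllable (L := reduceList ν μ L) hL.1 (ih hL.2)

variable {K : Type*} [Group K] {g : Letter → K}

theorem listValue_consNontrivial (hg : Satisfies ν μ g) (s : Syllable) (L : List Syllable) :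
    listValue g (consNontrivial ν μ s L) = syllableValue g s * listValue g L := by
  rw [consNontrivial]
  cases h : trivialTest ν μ s with
  | true => simp [syllableValue_eq_one hg h]
  | false => simp

theorem listValue_mulSyllable (hg : Satisfies ν μ g) (s : Syllable) (L : List Syllable) :
    listValue g (mulSyllable ν μ s L) = syllableValue g s * listValue g L := by
  cases L with
  | nil => exact listValue_consNontrivial hg s []
  | cons s' L =>
    rw [mulSyllable]
    by_cases hs : s'.1 = s.1
    · rw [decide_eq_true hs, cond_true, listValue_consNontrivial hg, syllableValue_add hg,
        listValue_cons, mul_assoc]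
      nth_rw 2 [← hs]
    · rw [decide_eq_false hs, cond_false, listValue_consNontrivial hg]

theorem listValue_reduceList (hg : Satisfies ν μ g) (L : List Syllable) :
    listValue g (reduceList ν μ L) = listValue g L := by
  induction L with
  | nil => rfl
  | cons s L ih =>
    rw [listValue_cons, ← ih]
    exact listValue_mulSyllable hg s _

end reduce

/-! ### Rewriting words into syllables, eliminating some of the `Ḃ_{n_i}`. -/

/-- The exponents of `x_m` (`true`) or `x_m⁻¹` (`false`). -/
def unitCoeff (m : Fin 2) (ε : Bool) : Coeff :=
  match m, ε with
  | 0, true => ((1, 0), (0, 0))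
  | 0, false => ((0, 1), (0, 0))
  | 1, true => ((0, 0), (1, 0))
  | 1, false => ((0, 0), (0, 1))

/-- The `i` in `I` with `ν i = n`. -/
def findIndex (I : List ℕ+) (n : ℕ+) : Option ℕ+ :=
  I.foldr (fun i o => bif ν i == n then some i else o) none

/-- The syllables of a letter, with `b_{n_i,m}` replaced by `t_i⁻¹ a_{n_i,m} t_i` for `i` in `I`. -/
def letterSyllables (I : List ℕ+) (l : Letter × Bool) : List Syllable :=
  match l.1 with
  | .inl (n, m) => [(.inl n, unitCoeff m l.2)]
  | .inr (.inl (n, m)) =>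
    match findIndex ν I n with
    | none => [(.inr (.inl n), unitCoeff m l.2)]
    | some i => [(.inr (.inr i), unitCoeff 0 false), (.inl n, unitCoeff m l.2),
        (.inr (.inr i), unitCoeff 0 true)]
  | .inr (.inr i) => [(.inr (.inr i), unitCoeff 0 l.2)]

/-- The indices of the letters `t_i` in a word. -/
def stableIndices (w : List (Letter × Bool)) : List ℕ+ :=
  w.foldr (fun l I => match l.1 with
    | .inl _ => I
    | .inr (.inl _) => I
    | .inr (.inr i) => i :: I) []

/-- The syllables of a word, with `b_{n_i,m}` replaced by `t_i⁻¹ a_{n_i,m} t_i` for `i` in `I`. -/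
def wordSyllables (I : List ℕ+) (w : List (Letter × Bool)) : List Syllable :=
  w.foldr (fun l L => letterSyllables ν I l ++ L) []

/-- A normal form of a word, empty if and only if the word represents `1` in `Ġ`. -/
def normalForm (w : List (Letter × Bool)) : List Syllable :=
  reduceList ν μ (wordSyllables ν (stableIndices w) w)

/-- The factors allowed once `b_{n_i,m}` has been eliminated for `i` in `I`. -/
def IsAdmissible (I : List ℕ+) : Index → Prop
  | .inl _ => True
  | .inr (.inl n) => ∀ i ∈ I, ν i ≠ n
  | .inr (.inr i) => i ∈ I

theorem findIndex_spec (I : List ℕ+) (n : ℕ+) :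
    (findIndex ν I n = none ∧ ∀ i ∈ I, ν i ≠ n) ∨
      ∃ i ∈ I, findIndex ν I n = some i ∧ ν i = n := by
  induction I with
  | nil => simp [findIndex]
  | cons i I ih =>
    have hfind : findIndex ν (i :: I) n = bif ν i == n then some i else findIndex ν I n := rfl
    by_cases h : ν i = n
    · exact .inr ⟨i, by simp, by rw [hfind, beq_iff_eq.2 h, cond_true], h⟩
    · rw [hfind, beq_eq_false_iff_ne.2 h, cond_false]
      rcases ih with ⟨h1, h2⟩ | ⟨j, hj, h1, h2⟩
      · exact .inl ⟨h1, by simpa [h] using h2⟩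
      · exact .inr ⟨j, by simp [hj], h1, h2⟩

theorem mem_stableIndices {w : List (Letter × Bool)} {i : ℕ+} {ε : Bool}
    (h : (Letter.t i, ε) ∈ w) : i ∈ stableIndices w := by
  induction w with
  | nil => simp at h
  | cons l w ih =>
    rcases List.mem_cons.1 h with rfl | h'
    · simp [stableIndices]
    · obtain ⟨_ | _ | _, _⟩ := l
      · exact ih h'
      · exact ih h'
      · exact List.mem_cons_of_mem _ (ih h')

theorem isAdmissible_letterSyllables {I : List ℕ+} {l : Letter × Bool}
    (hl : ∀ i, l.1 = .t i → i ∈ I) : ∀ s ∈ letterSyllables ν I l, IsAdmissible ν I s.1 := by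
  obtain ⟨⟨n, m⟩ | ⟨n, m⟩ | i, ε⟩ := l
  · simp [letterSyllables, IsAdmissible]
  · rcases findIndex_spec ν I n with ⟨h1, h2⟩ | ⟨j, hj, h1, h2⟩
    · simpa [letterSyllables, h1, IsAdmissible] using h2
    · simp [letterSyllables, h1, IsAdmissible, hj]
  · simpa [letterSyllables, IsAdmissible] using hl i rfl

theorem isAdmissible_wordSyllables {I : List ℕ+} {w : List (Letter × Bool)}
    (hw : ∀ i ε, (Letter.t i, ε) ∈ w → i ∈ I) :
    ∀ s ∈ wordSyllables ν I w, IsAdmissible ν I s.1 := by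
  induction w with
  | nil => simp [wordSyllables]
  | cons l w ih =>
    intro s hs
    rcases List.mem_append.1 hs with hs | hs
    · refine isAdmissible_letterSyllables ν (fun i hi => hw i l.2 ?_) s hs
      rw [← hi]
      exact List.mem_cons_self
    · exact ih (fun i ε h => hw i ε (List.mem_cons_of_mem _ h)) s hs

section value

variable {ν μ} {K : Type*} [Group K] {g : Letter → K}

/-- The relation is imposed only for `m = 0`. It passes to `m = 1` because both second generators
are the same power, with exponent `2^i`, of the first, and conjugation respects powers. -/
theorem Satisfies.conj_basis (hg : Satisfies ν μ g) (i : ℕ+) (m : Fin 2) :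
    (g (.t i))⁻¹ * g (.a (ν i) m) * g (.t i) = g (.b (ν i) m) := by
  match m with
  | 0 => exact hg.conj i
  | 1 =>
    rw [hg.pow_a_left, hg.pow_b_left, ← hg.conj]
    simpa using (conj_pow (a := (g (.t i))⁻¹) (b := g (.a (ν i) 0)) (i := 2 ^ (i : ℕ))).symm

theorem syllableValue_unitCoeff_a (n : ℕ+) (m : Fin 2) (ε : Bool) :
    syllableValue g (.inl n, unitCoeff m ε) = wordValue g [(.a n m, ε)] := by
  fin_cases m <;> cases ε <;> simp [syllableValue, unitCoeff, Coeff.x, Coeff.y]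

theorem syllableValue_unitCoeff_b (n : ℕ+) (m : Fin 2) (ε : Bool) :
    syllableValue g (.inr (.inl n), unitCoeff m ε) = wordValue g [(.b n m, ε)] := by
  fin_cases m <;> cases ε <;> simp [syllableValue, unitCoeff, Coeff.x, Coeff.y]

theorem syllableValue_unitCoeff_t (i : ℕ+) (ε : Bool) :
    syllableValue g (.inr (.inr i), unitCoeff 0 ε) = wordValue g [(.t i, ε)] := by
  cases ε <;> simp [syllableValue, unitCoeff, Coeff.x]

theorem listValue_letterSyllables (hg : Satisfies ν μ g) (I : List ℕ+) (l : Letter × Bool) :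
    listValue g (letterSyllables ν I l) = wordValue g [l] := by
  obtain ⟨⟨n, m⟩ | ⟨n, m⟩ | i, ε⟩ := l
  · simp [letterSyllables, syllableValue_unitCoeff_a]
  · rcases findIndex_spec ν I n with ⟨h1, -⟩ | ⟨j, -, h1, rfl⟩
    · simp [letterSyllables, h1, syllableValue_unitCoeff_b]
    · have h := hg.conj_basis j m
      simp only [letterSyllables, h1, listValue_cons, listValue_nil, mul_one,
        syllableValue_unitCoeff_t, syllableValue_unitCoeff_a, wordValue_cons_true,
        wordValue_cons_false, wordValue_nil]
      cases ε
      · simp only [wordValue_cons_false, wordValue_nil, mul_one]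
        rw [← h]
        group
      · simp only [wordValue_cons_true, wordValue_nil, mul_one]
        rw [← h]
        group
  · simp [letterSyllables, syllableValue_unitCoeff_t]

theorem listValue_wordSyllables (hg : Satisfies ν μ g) (I : List ℕ+) (w : List (Letter × Bool)) :
    listValue g (wordSyllables ν I w) = wordValue g w := by
  induction w with
  | nil => simp [wordSyllables]
  | cons l w ih =>
    refine (listValue_append _ _).trans ?_
    rw [listValue_letterSyllables hg]
    refine (congrArg _ ih).trans ?_
    rw [← wordValue_append, List.singleton_append]

theorem listValue_normalForm (hg : Satisfies ν μ g) (w : List (Letter × Bool)) :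
    listValue g (normalForm ν μ w) = wordValue g w := by
  rw [normalForm, listValue_reduceList hg, listValue_wordSyllables hg]

end value

/-! ### Detection of nontrivial elements in a free product of copies of `ℤ × ℤ`. -/

section detect

/-- A free product of copies of `ℤ × ℤ`, in which nontrivial elements of `Ġ` are detected. -/
abbrev Target : Type := Monoid.CoprodI fun _ : Index => Multiplicative (ℤ × ℤ)

/-- The element of the copy of `ℤ × ℤ` with index `k`. -/
def targetOf (k : Index) (v : ℤ × ℤ) : Target :=
  Monoid.CoprodI.of (M := fun _ : Index => Multiplicative (ℤ × ℤ)) (i := k)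
    (Multiplicative.ofAdd v)

theorem targetOf_add (k : Index) (v w : ℤ × ℤ) :
    targetOf k (v + w) = targetOf k v * targetOf k w := by
  rw [targetOf, ofAdd_add, map_mul]
  rfl

theorem targetOf_zsmul (k : Index) (v : ℤ × ℤ) (x : ℤ) :
    targetOf k (x • v) = targetOf k v ^ x := by
  rw [targetOf, ofAdd_zsmul, map_zpow]
  rfl

theorem targetOf_nsmul (k : Index) (v : ℤ × ℤ) (x : ℕ) :
    targetOf k (x • v) = targetOf k v ^ x := by
  rw [targetOf, ofAdd_nsmul, map_pow]
  rfl

theorem commute_targetOf (k : Index) (v w : ℤ × ℤ) :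
    Commute (targetOf k v) (targetOf k w) := by
  rw [Commute, SemiconjBy, ← targetOf_add, add_comm, targetOf_add]

theorem exists_neWord_targetOf (k : Index) {v : ℤ × ℤ} (hv : v ≠ 0) :
    ∃ w : Monoid.CoprodI.NeWord (fun _ : Index => Multiplicative (ℤ × ℤ)) k k,
      w.prod = targetOf k v :=
  ⟨.singleton (Multiplicative.ofAdd v) (by simpa using hv),
    Monoid.CoprodI.NeWord.prod_singleton _ _⟩

/-- Reduced words in a free product are determined by their product, and the empty word already
represents `1`. -/
theorem neWord_prod_ne_one {ι : Type*} {M : ι → Type*} [∀ i, Monoid (M i)] {i j : ι}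
    (w : Monoid.CoprodI.NeWord M i j) : w.prod ≠ 1 := by
  classical
  intro h
  have h' : w.toWord = Monoid.CoprodI.Word.empty := by
    apply Monoid.CoprodI.Word.equiv.symm.injective
    exact h.trans Monoid.CoprodI.Word.prod_empty.symm
  exact w.toList_ne_nil (congrArg Monoid.CoprodI.Word.toList h')

open Classical in
/-- The image of the second generator of `Ȧ_n` or `Ḃ_n` in `ℤ × ℤ`, the first going to `(1, 0)`. -/
noncomputable def slope (c : ℕ) (n : ℕ+) : ℤ × ℤ :=
  if h : ∃ i, ν i = n then (2 ^ (h.choose : ℕ), 0)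
  else if h : ∃ i, μ i = n then ((c : ℤ) ^ (h.choose : ℕ), 0)
  else (0, 1)

variable {ν μ}

theorem slope_left (hν : Function.Injective ν) (c : ℕ) (i : ℕ+) :
    slope ν μ c (ν i) = (2 ^ (i : ℕ), 0) := by
  have h : ∃ j, ν j = ν i := ⟨i, rfl⟩
  rw [slope, dif_pos h, hν h.choose_spec]

/-- Disjointness of the ranges excludes the first branch of `slope`; injectivity of `μ` makes the
chosen index equal to `i`. -/
theorem slope_right (hμ : Function.Injective μ) (hd : Disjoint (Set.range ν) (Set.range μ))
    (c : ℕ) (i : ℕ+) : slope ν μ c (μ i) = ((c : ℤ) ^ (i : ℕ), 0) := by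
  have h : ∃ j, μ j = μ i := ⟨i, rfl⟩
  have h' : ¬ ∃ j, ν j = μ i := fun ⟨j, hj⟩ =>
    Set.disjoint_left.1 hd (Set.mem_range_self j) ⟨i, hj.symm⟩
  rw [slope, dif_neg h', dif_pos h, hμ h.choose_spec]

/-- The vector with exponents `v`. -/
noncomputable def coeffVec (ν μ : ℕ+ → ℕ+) (c : ℕ) (n : ℕ+) (v : Coeff) : ℤ × ℤ :=
  Coeff.x v • ((1, 0) : ℤ × ℤ) + Coeff.y v • slope ν μ c n

/-- In each branch of `slope`, vanishing of the vector is exactly one of the three equations the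
test looks for. -/
theorem coeffVec_ne_zero {c : ℕ} (hc : 2 ≤ c) {n : ℕ+} {v : Coeff}
    (h : quotientTest ν μ c n v = false) : coeffVec ν μ c n v ≠ 0 := by
  intro h0
  rw [← Bool.not_eq_true, quotientTest_iff ν μ hc, not_or, not_or] at h
  obtain ⟨h1, h2, h3⟩ := h
  rw [coeffVec, slope] at h0
  split_ifs at h0 with hi hi'
  · refine h2 ⟨hi.choose, hi.choose_spec, ?_⟩
    simpa [mul_comm] using congrArg Prod.fst h0
  · refine h3 ⟨hi'.choose, hi'.choose_spec, ?_⟩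
    simpa [mul_comm] using congrArg Prod.fst h0
  · exact h1 (by simpa using h0)

variable (ν μ)

open Classical in
/-- The images of the generators of `Ġ` in `Target`: the generators of the `Ḃ_{n_i}` are mapped to
the conjugates of those of `Ȧ_{n_i}` by `t_i`. -/
noncomputable def targetGen : Letter → Target
  | .inl (n, m) => targetOf (.inl n) (if m = 0 then (1, 0) else slope ν μ 3 n)
  | .inr (.inl (n, m)) =>
    if h : ∃ i, ν i = n then
      (targetOf (.inr (.inr h.choose)) (1, 0))⁻¹ *
        targetOf (.inl n) (if m = 0 then (1, 0) else slope ν μ 3 n) *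
        targetOf (.inr (.inr h.choose)) (1, 0)
    else targetOf (.inr (.inl n)) (if m = 0 then (1, 0) else slope ν μ 2 n)
  | .inr (.inr i) => targetOf (.inr (.inr i)) (1, 0)

variable {ν μ}

theorem targetGen_b_left (hν : Function.Injective ν) (i : ℕ+) (m : Fin 2) :
    targetGen ν μ (.b (ν i) m) =
      (targetGen ν μ (.t i))⁻¹ * targetGen ν μ (.a (ν i) m) * targetGen ν μ (.t i) := by
  have h : ∃ j, ν j = ν i := ⟨i, rfl⟩
  refine (dif_pos h).trans ?_
  rw [hν h.choose_spec]
  rfl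

theorem targetGen_b_of_notMem {n : ℕ+} (hn : ¬ ∃ i, ν i = n) (m : Fin 2) :
    targetGen ν μ (.b n m) =
      targetOf (.inr (.inl n)) (if m = 0 then (1, 0) else slope ν μ 2 n) := by
  rw [targetGen, dif_neg hn]

theorem inv_mul_mul_pow {K : Type*} [Group K] (t a : K) (k : ℕ) :
    t⁻¹ * a ^ k * t = (t⁻¹ * a * t) ^ k := by
  simpa using (conj_pow (a := t⁻¹) (b := a) (i := k)).symm

theorem inv_mul_mul_zpow {K : Type*} [Group K] (t a : K) (k : ℤ) :
    t⁻¹ * a ^ k * t = (t⁻¹ * a * t) ^ k := by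
  simpa using (conj_zpow (a := t⁻¹) (b := a) (i := k)).symm

/-- Over the range of `ν` the relations for `b` are conjugates of those for `a`. Elsewhere, all
images of one factor lie in one commutative copy of `ℤ × ℤ`, and `slope` gives the power relations.
-/
theorem satisfies_targetGen (hν : Function.Injective ν) (hμ : Function.Injective μ)
    (hd : Disjoint (Set.range ν) (Set.range μ)) : Satisfies ν μ (targetGen ν μ) := by
  have pow_a : ∀ i, targetGen ν μ (.a (ν i) 1) = targetGen ν μ (.a (ν i) 0) ^ (2 ^ (i : ℕ)) := by
    intro i
    simp only [targetGen]
    rw [← targetOf_nsmul]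
    simp [slope_left hν]
  have hne : ∀ i, ¬ ∃ j, ν j = μ i := fun i ⟨j, hj⟩ =>
    Set.disjoint_left.1 hd (Set.mem_range_self j) ⟨i, hj.symm⟩
  refine ⟨fun n => commute_targetOf _ _ _, fun n => ?_, pow_a, fun i => ?_, fun i => ?_,
    fun i => ?_, fun i => (targetGen_b_left hν i 0).symm⟩
  · by_cases hn : ∃ i, ν i = n
    · obtain ⟨i, rfl⟩ := hn
      rw [targetGen_b_left hν, targetGen_b_left hν, pow_a, inv_mul_mul_pow]
      exact Commute.self_pow _ _
    · rw [targetGen_b_of_notMem hn, targetGen_b_of_notMem hn]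
      exact commute_targetOf _ _ _
  · simp only [targetGen]
    rw [← targetOf_nsmul]
    simp [slope_right hμ hd]
  · rw [targetGen_b_left hν, targetGen_b_left hν, pow_a, inv_mul_mul_pow]
  · rw [targetGen_b_of_notMem (hne i), targetGen_b_of_notMem (hne i), ← targetOf_nsmul]
    simp [slope_right hμ hd]

variable (ν) in
open Classical in
/-- The index of the first and the last factor of the image in `Target` of a syllable. -/
noncomputable def boundaryIndex : Index → Index
  | .inl n => .inl n
  | .inr (.inl n) => if h : ∃ i, ν i = n then .inr (.inr h.choose) else .inr (.inl n)
  | .inr (.inr i) => .inr (.inr i)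

/-- The only indices that can collide are those of `Ḃ_{n_i}` and `⟨t_i⟩`. They are never both
admissible: the former needs `i ∉ I`, the latter `i ∈ I`. -/
theorem boundaryIndex_injOn (I : List ℕ+) :
    Set.InjOn (boundaryIndex ν) {k | IsAdmissible ν I k} := by
  have haux : ∀ (n : ℕ+) (h : ∃ i, ν i = n), IsAdmissible ν I (.inr (.inl n)) → h.choose ∉ I :=
    fun n h hn hI => hn _ hI h.choose_spec
  rintro (n | n | i) hk (n' | n' | i') hk' h
  · exact h
  · simp only [boundaryIndex] at h
    split_ifs at h
  · exact h
  · simp only [boundaryIndex] at h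
    split_ifs at h
  · simp only [boundaryIndex] at h
    split_ifs at h with h1 h2
    · rw [← h1.choose_spec, ← h2.choose_spec]
      simp only [Sum.inr.injEq] at h
      rw [h]
    · simp at h
    · simp at h
    · exact h
  · simp only [boundaryIndex] at h
    split_ifs at h with h1
    · simp only [Sum.inr.injEq] at h
      exact absurd (h ▸ hk' : h1.choose ∈ I) (haux n h1 hk)
    · simp at h
  · exact h
  · simp only [boundaryIndex] at h
    split_ifs at h with h1
    · simp only [Sum.inr.injEq] at h
      exact absurd (h ▸ hk : h1.choose ∈ I) (haux n' h1 hk')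
    · simp at h
  · exact h

theorem syllableValue_targetGen_a (n : ℕ+) (v : Coeff) :
    syllableValue (targetGen ν μ) (.inl n, v) = targetOf (.inl n) (coeffVec ν μ 3 n v) := by
  rw [coeffVec, targetOf_add, targetOf_zsmul, targetOf_zsmul]
  rfl

/-- A nontrivial syllable of `Ḃ_{n_i}` becomes the three-letter reduced word `t_i⁻¹ a t_i`, which
begins and ends in `⟨t_i⟩`; every other nontrivial syllable becomes a single letter. -/
theorem exists_neWord_syllableValue (hν : Function.Injective ν) {s : Syllable}
    (hs : trivialTest ν μ s = false) :
    ∃ w : Monoid.CoprodI.NeWord (fun _ : Index => Multiplicative (ℤ × ℤ))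
      (boundaryIndex ν s.1) (boundaryIndex ν s.1),
      w.prod = syllableValue (targetGen ν μ) s := by
  obtain ⟨n | n | i, v⟩ := s
  · rw [syllableValue_targetGen_a]
    exact exists_neWord_targetOf _ (coeffVec_ne_zero (by norm_num) hs)
  · by_cases hn : ∃ i, ν i = n
    · obtain ⟨i, rfl⟩ := hn
      have hb : boundaryIndex ν (.inr (.inl (ν i))) = .inr (.inr i) := by
        have h : ∃ j, ν j = ν i := ⟨i, rfl⟩
        rw [boundaryIndex, dif_pos h, hν h.choose_spec]
      -- The test for `b` uses base `2` and the image lies in the copy for `a`, with base `3`; over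
      -- the range of `ν` the slope does not depend on that base.
      have hv : coeffVec ν μ 3 (ν i) v ≠ 0 := by
        have := coeffVec_ne_zero le_rfl hs
        rwa [coeffVec, slope_left hν] at this ⊢
      obtain ⟨w₁, hw₁⟩ := exists_neWord_targetOf (.inr (.inr i)) (v := (-1, 0)) (by simp)
      obtain ⟨w₂, hw₂⟩ := exists_neWord_targetOf (.inl (ν i)) hv
      obtain ⟨w₃, hw₃⟩ := exists_neWord_targetOf (.inr (.inr i)) (v := (1, 0)) (by simp)
      rw [show boundaryIndex ν (Sum.inr (Sum.inl (ν i)), v).1 = .inr (.inr i) from hb]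
      refine ⟨(w₁.append (by simp) w₂).append (by simp) w₃, ?_⟩
      have hinv : targetOf (.inr (.inr i)) (-1, 0) = (targetOf (.inr (.inr i)) (1, 0))⁻¹ := by
        rw [← zpow_neg_one, ← targetOf_zsmul]
        simp
      rw [Monoid.CoprodI.NeWord.append_prod, Monoid.CoprodI.NeWord.append_prod, hw₁, hw₂, hw₃,
        hinv, ← syllableValue_targetGen_a]
      simp only [syllableValue]
      rw [targetGen_b_left hν, targetGen_b_left hν, ← inv_mul_mul_zpow, ← inv_mul_mul_zpow]
      simp only [targetGen]
      group
    · have hb : boundaryIndex ν (.inr (.inl n)) = .inr (.inl n) := by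
        rw [boundaryIndex, dif_neg hn]
      rw [show boundaryIndex ν (Sum.inr (Sum.inl n), v).1 = .inr (.inl n) from hb]
      obtain ⟨w, hw⟩ := exists_neWord_targetOf (.inr (.inl n)) (coeffVec_ne_zero le_rfl hs)
      refine ⟨w, hw.trans ?_⟩
      simp only [syllableValue]
      rw [targetGen_b_of_notMem hn, targetGen_b_of_notMem hn, coeffVec, targetOf_add,
        targetOf_zsmul, targetOf_zsmul]
      rfl
  · have hx : Coeff.x v ≠ 0 := by
      have : v.1.1 ≠ v.1.2 := beq_eq_false_iff_ne.1 hs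
      simp only [Coeff.x]
      omega
    obtain ⟨w, hw⟩ := exists_neWord_targetOf (.inr (.inr i)) (v := Coeff.x v • (1, 0))
      (by simpa using hx)
    exact ⟨w, hw.trans (targetOf_zsmul _ _ _)⟩

/-- Neighbouring syllables have distinct admissible indices, hence distinct boundary factors, so
their images concatenate without cancellation. The fixed first factor in the conclusion keeps the
induction going. -/
theorem exists_neWord_listValue (hν : Function.Injective ν) {I : List ℕ+} (s : Syllable)
    (L : List Syllable) (h : IsReduced ν μ (s :: L))
    (hI : ∀ s' ∈ s :: L, IsAdmissible ν I s'.1) :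
    ∃ (k : Index) (w : Monoid.CoprodI.NeWord (fun _ : Index => Multiplicative (ℤ × ℤ))
      (boundaryIndex ν s.1) k), w.prod = listValue (targetGen ν μ) (s :: L) := by
  induction L generalizing s with
  | nil =>
    obtain ⟨w, hw⟩ := exists_neWord_syllableValue hν (h.2 s (by simp))
    exact ⟨_, w, by simp [hw]⟩
  | cons s' L ih =>
    obtain ⟨w, hw⟩ := exists_neWord_syllableValue hν (h.2 s (by simp))
    obtain ⟨k, w', hw'⟩ := ih s' h.tail fun x hx => hI x (List.mem_cons_of_mem _ hx)
    have hne : boundaryIndex ν s.1 ≠ boundaryIndex ν s'.1 := by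
      intro he
      refine (List.isChain_cons_cons.1 h.1).1 (boundaryIndex_injOn I ?_ ?_ he)
      · exact hI s (by simp)
      · exact hI s' (by simp)
    refine ⟨k, w.append hne w', ?_⟩
    rw [Monoid.CoprodI.NeWord.append_prod, hw, hw', listValue_cons (s := s)]

/-- Choosing `I` as the indices of the `t_i` in the word makes every syllable admissible, so a
nonempty normal form has nontrivial image in `Target`. -/
theorem wordValue_eq_one_iff (hν : Function.Injective ν) (hμ : Function.Injective μ)
    (hd : Disjoint (Set.range ν) (Set.range μ)) (w : List (Letter × Bool)) :
    wordValue (generator ν μ) w = 1 ↔ normalForm ν μ w = [] := by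
  rw [← listValue_normalForm (satisfies_generator ν μ)]
  constructor
  · intro h
    obtain ⟨f, hf⟩ := exists_lift ν μ (satisfies_targetGen hν hμ hd)
    have h1 : listValue (targetGen ν μ) (normalForm ν μ w) = 1 := by
      have := congrArg f h
      simpa [map_listValue, hf] using this
    have hred : IsReduced ν μ (normalForm ν μ w) := isReduced_reduceList _
    have hadm : ∀ s ∈ normalForm ν μ w, IsAdmissible ν (stableIndices w) s.1 :=
      forall_mem_reduceList
        (isAdmissible_wordSyllables ν fun i ε hi => mem_stableIndices hi)
    cases hL : normalForm ν μ w with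
    | nil => rfl
    | cons s L =>
      rw [hL] at h1 hred hadm
      obtain ⟨k, v, hv⟩ := exists_neWord_listValue hν s L hred hadm
      exact absurd (hv.trans h1) (neWord_prod_ne_one v)
  · intro h
    rw [h, listValue_nil]

end detect

end DotGroup

/-! ### General facts on computable functions. -/

section computability

open Encodable

variable {α β σ : Type*} [Primcodable α] [Primcodable β] [Primcodable σ]

theorem natRec_getElem?_eq_foldl {β σ : Type*} (l : List β) (s : σ) (h : β → σ → σ) (k : ℕ) :
    (Nat.rec s (fun n t => Option.casesOn (l[n]?) t fun b => h b t) k : σ) =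
      (l.take k).foldl (fun t b => h b t) s := by
  induction k with
  | zero => rfl
  | succ k ih =>
    rw [List.take_add_one, List.foldl_append, ← ih]
    change (Option.casesOn (l[k]?) (Nat.rec s _ k) fun b => h b (Nat.rec s _ k) : σ) = _
    cases l[k]? <;> rfl

/-- A right fold is a left fold over the reversed list, and the latter is a recursion on the
position, reading one entry at each stage. -/
theorem Computable.list_foldr {f : α → List β} {g : α → σ} {h : α → β × σ → σ}
    (hf : Computable f) (hg : Computable g) (hh : Computable₂ h) :
    Computable fun a => (f a).foldr (fun b s => h a (b, s)) (g a) := by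
  have hl : Computable fun a => (f a).reverse := Computable.list_reverse.comp hf
  have hget : Computable fun p : α × ℕ × σ => (f p.1).reverse[p.2.1]? :=
    Computable.list_getElem?.comp (hl.comp .fst) (Computable.fst.comp .snd)
  have hstep : Computable₂ fun (p : α × ℕ × σ) (b : β) => h p.1 (b, p.2.2) :=
    hh.comp (Computable.fst.comp .fst)
      (Computable.snd.pair (Computable.snd.comp (Computable.snd.comp .fst)))
  refine (Computable.nat_rec (Computable.list_length.comp hl) hg
    (Computable.option_casesOn hget (Computable.snd.comp .snd) hstep).to₂).of_eq fun a => ?_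
  refine (natRec_getElem?_eq_foldl (f a).reverse (g a) (fun b s => h a (b, s)) _).trans ?_
  rw [List.take_length, List.foldl_reverse]

theorem Computable.list_any {f : α → List β} {p : α → β → Bool}
    (hf : Computable f) (hp : Computable₂ p) : Computable fun a => (f a).any (p a) := by
  refine (Computable.list_foldr (h := fun a q => p a q.1 || q.2) hf (Computable.const false)
    (Primrec.or.to_comp.comp (hp.comp .fst (Computable.fst.comp .snd))
      (Computable.snd.comp .snd)).to₂).of_eq fun a => ?_
  induction f a with
  | nil => rfl
  | cons b l ih => rw [List.foldr_cons, ih, List.any_cons]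

/-- Semidecided by an unbounded search through the codes of elements of `β` for a preimage. -/
theorem REPred.exists_eq {f : β → α} (hf : Computable f) : REPred fun a => ∃ b, f b = a := by
  classical
  have hP : Computable₂ fun (a : α) (n : ℕ) =>
      (decode n : Option β).bind fun b => bif decide (f b = a) then some () else none := by
    refine Computable.option_bind (Computable.decode.comp .snd) ?_
    refine Computable.cond (Primrec.eq.decide.to_comp.comp (hf.comp .snd)
      (Computable.fst.comp .fst)) (Computable.const _) (Computable.const _)
  refine (Partrec.rfindOpt hP).dom_re.of_eq fun a => ?_
  rw [Nat.rfindOpt_dom]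
  constructor
  · rintro ⟨n, ⟨⟩, h⟩
    obtain ⟨b, -, hb⟩ := Option.bind_eq_some_iff.1 h
    by_cases hab : f b = a
    · exact ⟨b, hab⟩
    · simp [hab] at hb
  · rintro ⟨b, rfl⟩
    exact ⟨encode b, (), by simp⟩

theorem Computable.sumElim {γ : Type*} [Primcodable γ] {f : β → α} {g : γ → α}
    (hf : Computable f) (hg : Computable g) : Computable (Sum.elim f g) :=
  (Computable.sumCasesOn (g := fun _ b => f b) (h := fun _ c => g c) Computable.id
    (hf.comp .snd) (hg.comp .snd)).of_eq fun x => by cases x <;> rfl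

theorem Primrec.natPow : Primrec₂ ((· ^ ·) : ℕ → ℕ → ℕ) :=
  Primrec₂.unpaired'.1 Nat.Primrec.pow

theorem Primrec.succPNat : Primrec Nat.succPNat :=
  (Primrec.ofNat ℕ+).of_eq fun _ => rfl

theorem Primrec.pnatVal : Primrec (fun n : ℕ+ => (n : ℕ)) :=
  (Primrec.succ.comp Primrec.encode).of_eq fun n => PNat.natPred_add_one n

theorem Primrec.listReplicate : Primrec₂ (List.replicate : ℕ → α → List α) := by
  have h : Primrec fun p : ℕ × α => List.replicate p.1 p.2 :=
    (Primrec.list_map (g := fun (p : ℕ × α) (_ : ℕ) => p.2)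
      (Primrec.list_range.comp Primrec.fst) (Primrec.snd.comp Primrec.fst)).of_eq fun p => by simp
  exact h

end computability

namespace DotGroup

variable {ν μ : ℕ+ → ℕ+}

/-! ### Recursive enumerability of the relators. -/

section relators

variable {α : Type*} [Primcodable α]

theorem computable_cons {β : Type*} [Primcodable β] {f : α → β} {g : α → List β}
    (hf : Computable f) (hg : Computable g) : Computable fun a => f a :: g a :=
  Computable.list_cons.comp hf hg

theorem computable_commWord {x y : α → Letter} (hx : Computable x) (hy : Computable y) :
    Computable fun a => commWord (x a) (y a) :=
  computable_cons (hx.pair (.const true)) <| computable_cons (hy.pair (.const true)) <|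
    computable_cons (hx.pair (.const false)) <| computable_cons (hy.pair (.const false)) <|
    .const []

theorem computable_powWord {x y : α → Letter} {k : α → ℕ} (hx : Computable x)
    (hy : Computable y) (hk : Computable k) : Computable fun a => powWord (x a) (y a) (k a) :=
  computable_cons (hx.pair (.const false)) <|
    Primrec.listReplicate.to_comp.comp hk (hy.pair (.const true))

theorem computable_a {f : α → ℕ+} (hf : Computable f) (m : Fin 2) :
    Computable fun a => Letter.a (f a) m :=
  Computable.sumInl.comp (hf.pair (.const m))

theorem computable_b {f : α → ℕ+} (hf : Computable f) (m : Fin 2) :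
    Computable fun a => Letter.b (f a) m :=
  Computable.sumInr.comp (Computable.sumInl.comp (hf.pair (.const m)))

theorem computable_t {f : α → ℕ+} (hf : Computable f) : Computable fun a => Letter.t (f a) :=
  Computable.sumInr.comp (Computable.sumInr.comp hf)

theorem computable_conjWord {f g : α → ℕ+} (hf : Computable f) (hg : Computable g) :
    Computable fun a => conjWord (f a) (g a) :=
  computable_cons ((computable_t hf).pair (.const false)) <|
    computable_cons ((computable_a hg 0).pair (.const true)) <|
    computable_cons ((computable_t hf).pair (.const true)) <|
    computable_cons ((computable_b hg 0).pair (.const false)) <| .const []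

theorem computable_const_pow (c : ℕ) : Computable fun i : ℕ+ => c ^ (i : ℕ) :=
  (Primrec.natPow.comp (.const c) Primrec.pnatVal).to_comp

/-- The relators form the range of one computable map on a disjoint sum of seven copies of `ℕ+`, one
for each family. -/
theorem rePred_relatorWords (hν : Computable ν) (hμ : Computable μ) :
    REPred fun w => w ∈ relatorWords ν μ := by
  have hrange := REPred.exists_eq <|
    (computable_commWord (computable_a .id 0) (computable_a .id 1)).sumElim <|
    (computable_commWord (computable_b .id 0) (computable_b .id 1)).sumElim <|
    (computable_powWord (computable_a hν 1) (computable_a hν 0) (computable_const_pow 2)).sumElim <|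
    (computable_powWord (computable_a hμ 1) (computable_a hμ 0) (computable_const_pow 3)).sumElim <|
    (computable_powWord (computable_b hν 1) (computable_b hν 0) (computable_const_pow 2)).sumElim <|
    (computable_powWord (computable_b hμ 1) (computable_b hμ 0) (computable_const_pow 2)).sumElim <|
    computable_conjWord .id hν
  refine hrange.of_eq fun w => ?_
  simp only [Sum.exists, Sum.elim_inl, Sum.elim_inr, id_eq, relatorWords, Set.mem_ofPred_eq,
    eq_comm (b := w)]

end relators

/-! ### Computability of the normal form and the word problem. -/

section algorithm

variable {α : Type*} [Primcodable α]

theorem computable_beq {β : Type*} [Primcodable β] [DecidableEq β] {f g : α → β}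
    (hf : Computable f) (hg : Computable g) : Computable fun a => f a == g a :=
  Primrec.beq.to_comp.comp hf hg

theorem computable_and {f g : α → Bool} (hf : Computable f) (hg : Computable g) :
    Computable fun a => f a && g a :=
  Primrec.and.to_comp.comp hf hg

theorem computable_or {f g : α → Bool} (hf : Computable f) (hg : Computable g) :
    Computable fun a => f a || g a :=
  Primrec.or.to_comp.comp hf hg

theorem computable_add {f g : α → ℕ} (hf : Computable f) (hg : Computable g) :
    Computable fun a => f a + g a :=
  Primrec.nat_add.to_comp.comp hf hg

theorem computable_relationTest (c : ℕ) {f : ℕ+ → ℕ+} (hf : Computable f) {n : α → ℕ+}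
    {v : α → Coeff} {i : α → ℕ} (hn : Computable n) (hv : Computable v) (hi : Computable i) :
    Computable fun a => relationTest c f (n a) (v a) (i a) := by
  have hpow : Computable fun a => c ^ (i a + 1) :=
    Primrec.natPow.to_comp.comp (.const c) (Computable.succ.comp hi)
  have h1 : Computable fun a => (v a).1 := Computable.fst.comp hv
  have h2 : Computable fun a => (v a).2 := Computable.snd.comp hv
  exact computable_and
    (computable_beq (hf.comp (Primrec.succPNat.to_comp.comp hi)) hn)
    (computable_beq
      (computable_add (Computable.fst.comp h1)
        (Primrec.nat_mul.to_comp.comp hpow (Computable.fst.comp h2)))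
      (computable_add (Computable.snd.comp h1)
        (Primrec.nat_mul.to_comp.comp hpow (Computable.snd.comp h2))))

theorem computable_quotientTest (hν : Computable ν) (hμ : Computable μ) (c : ℕ) {n : α → ℕ+}
    {v : α → Coeff} (hn : Computable n) (hv : Computable v) :
    Computable fun a => quotientTest ν μ c (n a) (v a) := by
  have h1 : Computable fun a => (v a).1 := Computable.fst.comp hv
  have h2 : Computable fun a => (v a).2 := Computable.snd.comp hv
  refine computable_or (computable_and
    (computable_beq (Computable.fst.comp h1) (Computable.snd.comp h1))
    (computable_beq (Computable.fst.comp h2) (Computable.snd.comp h2))) ?_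
  refine Computable.list_any (Primrec.list_range.to_comp.comp
    (computable_add (Computable.fst.comp h1) (Computable.snd.comp h1))) ?_
  exact computable_or
    (computable_relationTest 2 hν (hn.comp .fst) (hv.comp .fst) .snd)
    (computable_relationTest c hμ (hn.comp .fst) (hv.comp .fst) .snd)

theorem computable_index_casesOn {σ : Type*} [Primcodable σ] {β γ δ : Type*} [Primcodable β]
    [Primcodable γ] [Primcodable δ] {k : α → β ⊕ γ ⊕ δ} {f : α × β → σ} {g : α × γ → σ}
    {h : α × δ → σ} (hk : Computable k) (hf : Computable f) (hg : Computable g)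
    (hh : Computable h) : Computable fun a => (match k a with
      | .inl x => f (a, x)
      | .inr (.inl x) => g (a, x)
      | .inr (.inr x) => h (a, x) : σ) := by
  refine (Computable.sumCasesOn (g := fun a x => f (a, x))
    (h := fun a y => Sum.casesOn y (fun x => g (a, x)) (fun x => h (a, x))) hk hf
    (Computable.sumCasesOn .snd
      (hg.comp ((Computable.fst.comp .fst).pair .snd)).to₂
      (hh.comp ((Computable.fst.comp .fst).pair .snd)).to₂).to₂).of_eq fun a => ?_
  rcases k a with _ | _ | _ <;> rfl

theorem computable_trivialTest (hν : Computable ν) (hμ : Computable μ) :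
    Computable (trivialTest ν μ) := by
  refine (computable_index_casesOn (k := fun s : Syllable => s.1) .fst
    (computable_quotientTest hν hμ 3 .snd (Computable.snd.comp .fst))
    (computable_quotientTest hν hμ 2 .snd (Computable.snd.comp .fst))
    (h := fun p => p.1.2.1.1 == p.1.2.1.2) ?_).of_eq fun s => ?_
  · have h1 : Computable fun p : Syllable × ℕ+ => p.1.2.1 :=
      Computable.fst.comp (Computable.snd.comp .fst)
    exact computable_beq (Computable.fst.comp h1) (Computable.snd.comp h1)
  · obtain ⟨_ | _ | _, _⟩ := s <;> rfl

theorem computable_consNontrivial (hν : Computable ν) (hμ : Computable μ) {s : α → Syllable}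
    {L : α → List Syllable} (hs : Computable s) (hL : Computable L) :
    Computable fun a => consNontrivial ν μ (s a) (L a) :=
  Computable.cond ((computable_trivialTest hν hμ).comp hs) hL (computable_cons hs hL)

theorem computable_coeff_add {v w : α → Coeff} (hv : Computable v) (hw : Computable w) :
    Computable fun a => v a + w a := by
  have v1 : Computable fun a => (v a).1 := Computable.fst.comp hv
  have v2 : Computable fun a => (v a).2 := Computable.snd.comp hv
  have w1 : Computable fun a => (w a).1 := Computable.fst.comp hw
  have w2 : Computable fun a => (w a).2 := Computable.snd.comp hw
  exact .pair
    (.pair (computable_add (Computable.fst.comp v1) (Computable.fst.comp w1))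
      (computable_add (Computable.snd.comp v1) (Computable.snd.comp w1)))
    (.pair (computable_add (Computable.fst.comp v2) (Computable.fst.comp w2))
      (computable_add (Computable.snd.comp v2) (Computable.snd.comp w2)))

/-- The case split on the list is made on `head?`, the rest of the list being recovered as `tail`.
-/
theorem computable_mulSyllable (hν : Computable ν) (hμ : Computable μ) {s : α → Syllable}
    {L : α → List Syllable} (hs : Computable s) (hL : Computable L) :
    Computable fun a => mulSyllable ν μ (s a) (L a) := by
  have hs1 : Computable fun p : α × Syllable => s p.1 := hs.comp .fst
  have hL1 : Computable fun p : α × Syllable => L p.1 := hL.comp .fst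
  refine (Computable.option_casesOn (o := fun a => (L a).head?)
    (f := fun a => consNontrivial ν μ (s a) [])
    (g := fun a s' => bif decide (s'.1 = (s a).1) then
      consNontrivial ν μ ((s a).1, (s a).2 + s'.2) (L a).tail
      else consNontrivial ν μ (s a) (L a))
    (Primrec.list_head?.to_comp.comp hL)
    (computable_consNontrivial hν hμ hs (.const [])) ?_).of_eq fun a => ?_
  · exact Computable.cond
      (Primrec.eq.decide.to_comp.comp (Computable.fst.comp .snd) (Computable.fst.comp hs1))
      (computable_consNontrivial hν hμ
        ((Computable.fst.comp hs1).pair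
          (computable_coeff_add (Computable.snd.comp hs1) (Computable.snd.comp .snd)))
        (Primrec.list_tail.to_comp.comp hL1))
      (computable_consNontrivial hν hμ hs1 hL1)
  · cases L a <;> rfl

theorem computable_reduceList (hν : Computable ν) (hμ : Computable μ) :
    Computable (reduceList ν μ) :=
  Computable.list_foldr (f := id) (h := fun _ p => mulSyllable ν μ p.1 p.2) .id (.const [])
    (computable_mulSyllable hν hμ (Computable.fst.comp .snd) (Computable.snd.comp .snd)).to₂

theorem computable_uncurry_unitCoeff : Computable (Function.uncurry unitCoeff) :=
  -- The domain `Fin 2 × Bool` is finite.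
  (Primrec.dom_finite _).to_comp

theorem computable_uncurry_unitCoeff_comp {m : α → Fin 2} {ε : α → Bool} (hm : Computable m)
    (hε : Computable ε) : Computable fun a => Function.uncurry unitCoeff (m a, ε a) :=
  computable_uncurry_unitCoeff.comp (hm.pair hε)

theorem computable_unitCoeff {m : α → Fin 2} {ε : α → Bool} (hm : Computable m)
    (hε : Computable ε) : Computable fun a => unitCoeff (m a) (ε a) :=
  computable_uncurry_unitCoeff_comp hm hε

theorem computable_findIndex (hν : Computable ν) {I : α → List ℕ+} {n : α → ℕ+}
    (hI : Computable I) (hn : Computable n) : Computable fun a => findIndex ν (I a) (n a) :=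
  Computable.list_foldr (h := fun a p => bif ν p.1 == n a then some p.1 else p.2) hI
    (.const none)
    (Computable.cond
      (computable_beq (hν.comp (Computable.fst.comp .snd)) (hn.comp .fst))
      (Computable.option_some.comp (Computable.fst.comp .snd)) (Computable.snd.comp .snd)).to₂

theorem computable_singleton {β : Type*} [Primcodable β] {f : α → β} (hf : Computable f) :
    Computable fun a => [f a] :=
  computable_cons hf (.const [])

theorem computable_letterSyllables (hν : Computable ν) {I : α → List ℕ+} {l : α → Letter × Bool}
    (hI : Computable I) (hl : Computable l) :
    Computable fun a => letterSyllables ν (I a) (l a) := by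
  have ha : ∀ {β : Type _} [Primcodable β] {n : β → ℕ+}, Computable n →
      Computable fun b => (Sum.inl (n b) : Index) := fun h => Computable.sumInl.comp h
  have hb : ∀ {β : Type _} [Primcodable β] {n : β → ℕ+}, Computable n →
      Computable fun b => (Sum.inr (Sum.inl (n b)) : Index) :=
    fun h => Computable.sumInr.comp (Computable.sumInl.comp h)
  have ht : ∀ {β : Type _} [Primcodable β] {n : β → ℕ+}, Computable n →
      Computable fun b => (Sum.inr (Sum.inr (n b)) : Index) :=
    fun h => Computable.sumInr.comp (Computable.sumInr.comp h)
  have hε : ∀ {β : Type _} [Primcodable β], Computable fun p : α × β => (l p.1).2 :=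
    Computable.snd.comp (hl.comp .fst)
  have hu : Computable fun p : α × ℕ+ × Fin 2 => unitCoeff p.2.2 (l p.1).2 :=
    computable_unitCoeff (Computable.snd.comp .snd) hε
  have hfind : Computable fun p : α × ℕ+ × Fin 2 => findIndex ν (I p.1) p.2.1 :=
    computable_findIndex hν (hI.comp .fst) (Computable.fst.comp .snd)
  refine (computable_index_casesOn (k := fun a => (l a).1) (Computable.fst.comp hl)
    (f := fun p => [(.inl p.2.1, unitCoeff p.2.2 (l p.1).2)])
    (g := fun p => Option.casesOn (findIndex ν (I p.1) p.2.1)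
      [(.inr (.inl p.2.1), unitCoeff p.2.2 (l p.1).2)]
      fun i => [(.inr (.inr i), unitCoeff 0 false), (.inl p.2.1, unitCoeff p.2.2 (l p.1).2),
        (.inr (.inr i), unitCoeff 0 true)])
    (h := fun p => [(.inr (.inr p.2), unitCoeff 0 (l p.1).2)]) ?_ ?_ ?_).of_eq fun a => ?_
  · exact computable_singleton ((ha (Computable.fst.comp .snd)).pair hu)
  · refine Computable.option_casesOn hfind
      (computable_singleton ((hb (Computable.fst.comp .snd)).pair hu)) ?_
    exact computable_cons ((ht .snd).pair (.const _)) <|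
      computable_cons ((ha (Computable.fst.comp (Computable.snd.comp .fst))).pair
        (hu.comp .fst)) <| computable_singleton ((ht .snd).pair (.const _))
  · exact computable_singleton ((ht .snd).pair (computable_unitCoeff (.const 0) hε))
  · rw [letterSyllables]
    rcases (l a).1 with _ | ⟨n, m⟩ | _
    · rfl
    · dsimp only
      cases findIndex ν (I a) n <;> rfl
    · rfl

theorem computable_stableIndices : Computable stableIndices := by
  refine Computable.list_foldr (f := id)
    (h := fun _ (p : (Letter × Bool) × List ℕ+) => match p.1.1 with
    | .inl _ => p.2
    | .inr (.inl _) => p.2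
    | .inr (.inr i) => i :: p.2) .id (.const []) ?_
  refine (computable_index_casesOn
    (k := fun q : List (Letter × Bool) × (Letter × Bool) × List ℕ+ => q.2.1.1)
    (f := fun q => q.1.2.2) (g := fun q => q.1.2.2) (h := fun q => q.2 :: q.1.2.2)
    (Computable.fst.comp (Computable.fst.comp .snd))
    (Computable.snd.comp (Computable.snd.comp .fst))
    (Computable.snd.comp (Computable.snd.comp .fst))
    (computable_cons .snd (Computable.snd.comp (Computable.snd.comp .fst)))).of_eq fun q => ?_
  obtain ⟨w, ⟨_ | _ | _, ε⟩, I⟩ := q <;> rfl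

theorem computable_normalForm (hν : Computable ν) (hμ : Computable μ) :
    Computable (normalForm ν μ) := by
  refine (computable_reduceList hν hμ).comp ?_
  exact Computable.list_foldr (f := id)
    (h := fun w p => letterSyllables ν (stableIndices w) p.1 ++ p.2) .id (.const [])
    (Computable.list_append.comp
      (computable_letterSyllables hν (computable_stableIndices.comp .fst)
        (Computable.fst.comp .snd))
      (Computable.snd.comp .snd)).to₂

theorem computable_invRev {X : Type*} [Primcodable X] :
    Computable (FreeGroup.invRev : List (X × Bool) → List (X × Bool)) :=
  (Primrec.list_reverse.comp (Primrec.list_map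
    (g := fun (_ : List (X × Bool)) (x : X × Bool) => (x.1, !x.2)) .id
    ((Primrec.fst.comp .snd).pair (Primrec.not.comp (Primrec.snd.comp .snd))).to₂)).to_comp

theorem computablePred_wordProblem (hν : Computable ν) (hμ : Computable μ)
    (hν_inj : Function.Injective ν) (hμ_inj : Function.Injective μ)
    (hd : Disjoint (Set.range ν) (Set.range μ)) :
    ComputablePred fun p : List (Letter × Bool) × List (Letter × Bool) =>
      wordValue (generator ν μ) p.1 = wordValue (generator ν μ) p.2 := by
  -- Two words agree in `Ġ` iff the first followed by the formal inverse of the second is trivial.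
  have h : Computable fun p : List (Letter × Bool) × List (Letter × Bool) =>
      decide (normalForm ν μ (p.1 ++ FreeGroup.invRev p.2) = []) :=
    Primrec.eq.decide.to_comp.comp
      ((computable_normalForm hν hμ).comp
        (Computable.list_append.comp .fst (computable_invRev.comp .snd))) (.const [])
  refine (Computable.computablePred h).of_eq fun p => ?_
  rw [← wordValue_eq_one_iff hν_inj hμ_inj hd, wordValue_append, wordValue_invRev, mul_inv_eq_one]

end algorithm

end DotGroup

theorem lemma11 (ν μ : ℕ+ → ℕ+)
    (hν : Computable ν) (hμ : Computable μ)
    (hν_inj : Function.Injective ν) (hμ_inj : Function.Injective μ)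
    (hinsep : RecursivelyInseparable (Set.range ν) (Set.range μ)) :
    IsComputablePresentation (DotGroup.generator ν μ) (DotGroup.relatorWords ν μ) where
  surjective := DotGroup.lift_generator_surjective ν μ
  ker_eq := DotGroup.ker_lift_generator ν μ
  relators_re := DotGroup.rePred_relatorWords hν hμ
  wordProblem := DotGroup.computablePred_wordProblem hν hμ hν_inj hμ_inj hinsep.1
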